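/- Let $\mathbb F$ be an algebraically closed field of characteristic $0$ and let $n\ge 0$. An affine operator is a map $f:\mathbb F^n\to\mathbb F^n$, $f(x)=Ax+b$, with $A\in\mathbb F^{n\times n}$ and $b\in\mathbb F^n$. Two maps $f,g:\mathbb F^n\to\mathbb F^n$ are biregularly conjugate if $g=h^{-1}fh$ for some bijection $h:\mathbb F^n\to\mathbb F^n$ such that all coordinate functions of $h$ and of $h^{-1}$ are polynomials over $\mathbb F$. Matrices $A,B$ of the same size are similar if $A=S^{-1}BS$ for some nonsingular $S$. Every square matrix $A$ over $\mathbb F$ is similar to a direct sum $A_*\oplus A_\circ$ in which $A_*$ is nonsingular and $A_\circ$ is nilpotent (either summand may have size $0$); fix any such matrices for each $A$ below. (a) Let $f(x)=Ax+b$ and $g(x)=Cx+d$ be affine operators on $\mathbb F^n$. (i) If $f$ and $g$ both have fixed points, then $f$ and $g$ are biregularly conjugate if and only if $A$ and $C$ are similar. (ii) If neither $f$ nor $g$ has a fixed point, then $f$ and $g$ are biregularly conjugate if and only if $A_*$ and $C_*$ have the same eigenvalues with the same (algebraic) multiplicities, and $A_\circ$ and $C_\circ$ are similar (in particular, of the same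 size). (b) Let $f(x)=Ax+b$ be an affine operator on $\mathbb F^n$. (i) If $f$ has a fixed point, then $f$ is biregularly conjugate to the linear operator $x\mapsto Jx$, where $J$ is the Jordan canonical form of $A$. The Jordan matrix $J$ is uniquely determined by $f$ up to permutation of blocks: if $f$ is biregularly conjugate to $x\mapsto Jx$, with $J$ a Jordan matrix, then for every Jordan matrix $J'$, $f$ is biregularly conjugate to $x\mapsto J'x$ if and only if $J$ and $J'$ coincide up to permutation of blocks. (ii) If $f$ has no fixed point, and $A_*$ is $k\times k$, then $k\ge 1$, $1$ is an eigenvalue of $A_*$, and $f$ is biregularly conjugate to $$(x_1,\dots,x_n)\mapsto (x_1+1,\ \alpha_2x_2,\ \dots,\ \alpha_kx_k,\ J_\circ\tilde x),\qquad \tilde x=(x_{k+1},\dots,x_n)^T,$$ where $1,\alpha_2,\dots,\alpha_k\in\mathbb F\setminus\{0\}$ are all the eigenvalues of $A_*$ repeated according to their multiplicities, and $J_\circ$ is the Jordan canonical form of $A_\circ$. Among the operators of this form (with any $k\in\{1,\dots,n\}$, any nonzero $\alpha_2,\dots,\alpha_k$ and any nilpotent Jordan matrix $J_\circ$ of size $n-k$),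 the operator is uniquely determined by $f$ up to permutation of $\alpha_2,\dots,\alpha_k$ and permutation of blocks in $J_\circ$; conversely, every such permutation gives an operator biregularly conjugate to $f$. -/

import Mathlib

open scoped Matrix

namespace AffineBiregular

/-- A self-map of `F^n` all of whose coordinate functions are polynomials over `F`. -/
def IsPolynomialMap {F : Type*} [Field F] {n : ℕ} (h : (Fin n → F) → (Fin n → F)) : Prop :=
  ∃ p : Fin n → MvPolynomial (Fin n) F, ∀ x i, h x i = MvPolynomial.eval x (p i)

/-- A bijection `h` of `F^n` is biregular if `h` and its inverse are polynomial maps. -/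
def IsBiregular {F : Type*} [Field F] {n : ℕ} (h : (Fin n → F) ≃ (Fin n → F)) : Prop :=
  IsPolynomialMap (fun x => h x) ∧ IsPolynomialMap (fun x => h.symm x)

/-- `f` and `g` are biregularly conjugate if `g = h⁻¹ f h` for some biregular bijection `h`. -/
def BiregularlyConjugate {F : Type*} [Field F] {n : ℕ}
    (f g : (Fin n → F) → (Fin n → F)) : Prop :=
  ∃ h : (Fin n → F) ≃ (Fin n → F), IsBiregular h ∧ ∀ x, g x = h.symm (f (h x))

/-- The affine operator `x ↦ A x + b`. -/
def affineOperator {F : Type*} [Field F] {n : ℕ} (A : Matrix (Fin n) (Fin n) F) (b : Fin n → F) :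
    (Fin n → F) → (Fin n → F) :=
  fun x => A *ᵥ x + b

/-- `f` has a fixed point. -/
def HasFixedPoint {X : Type*} (f : X → X) : Prop :=
  ∃ x, f x = x

/-- Similarity of square matrices of the same size: `A = S⁻¹ B S` with `S` nonsingular. -/
def SimilarMatrix {F : Type*} [Field F] {n : ℕ} (A B : Matrix (Fin n) (Fin n) F) : Prop :=
  ∃ S : Matrix (Fin n) (Fin n) F, IsUnit S ∧ A = S⁻¹ * B * S

/-- A matrix of size `m`, regarded as a matrix of size `n` when `m = n`. -/
def castMatrix {F : Type*} [Field F] {m n : ℕ} (h : m = n) (A : Matrix (Fin m) (Fin m) F) :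
    Matrix (Fin n) (Fin n) F :=
  A.submatrix (Fin.cast h.symm) (Fin.cast h.symm)

/-- The direct sum `A ⊕ B` (block diagonal matrix with blocks `A` and `B`, in this order). -/
def directSum {F : Type*} [Field F] {p q : ℕ} (A : Matrix (Fin p) (Fin p) F)
    (B : Matrix (Fin q) (Fin q) F) : Matrix (Fin (p + q)) (Fin (p + q)) F :=
  Matrix.reindex finSumFinEquiv finSumFinEquiv (Matrix.fromBlocks A 0 0 B)

/-- `A` is similar to `As ⊕ Ao`, where `As` is nonsingular and `Ao` is nilpotent. -/
def IsStarCircDecomposition {F : Type*} [Field F] {n k m : ℕ} (h : k + m = n)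
    (A : Matrix (Fin n) (Fin n) F) (As : Matrix (Fin k) (Fin k) F)
    (Ao : Matrix (Fin m) (Fin m) F) : Prop :=
  IsUnit As ∧ IsNilpotent Ao ∧ SimilarMatrix A (castMatrix h (directSum As Ao))

/-- The `d × d` Jordan block with eigenvalue `μ` (ones on the superdiagonal). -/
def jordanBlock {F : Type*} [Field F] (d : ℕ) (μ : F) : Matrix (Fin d) (Fin d) F :=
  Matrix.of fun i j => if i = j then μ else if (i : ℕ) + 1 = (j : ℕ) then 1 else 0

/-- The sum of the sizes in a list of pairs (size, eigenvalue). -/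
def jordanSize {F : Type*} : List (ℕ × F) → ℕ
  | [] => 0
  | b :: L => b.1 + jordanSize L

/-- The direct sum of the Jordan blocks listed in `L` as pairs (size, eigenvalue). -/
def jordanMatrix {F : Type*} [Field F] :
    (L : List (ℕ × F)) → Matrix (Fin (jordanSize L)) (Fin (jordanSize L)) F
  | [] => 0
  | b :: L => directSum (jordanBlock b.1 b.2) (jordanMatrix L)

/-- `J` is a Jordan matrix, and `L` is the list of its blocks (of positive sizes), in order. -/
def IsJordanMatrix {F : Type*} [Field F] {n : ℕ} (J : Matrix (Fin n) (Fin n) F)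
    (L : List (ℕ × F)) : Prop :=
  (∀ b ∈ L, 0 < b.1) ∧ ∃ h : jordanSize L = n, J = castMatrix h (jordanMatrix L)

/-- `J`, with list of blocks `L`, is a Jordan canonical form of `A`. -/
def IsJordanForm {F : Type*} [Field F] {n : ℕ} (A J : Matrix (Fin n) (Fin n) F)
    (L : List (ℕ × F)) : Prop :=
  IsJordanMatrix J L ∧ SimilarMatrix A J

/-- With `k = p + 1` and `n = k + m`, the operator
`(x₁, …, xₙ) ↦ (x₁ + 1, α₂ x₂, …, α_k x_k, J (x_{k+1}, …, xₙ))`;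
the entries of `α : Fin p → F` are `α₂, …, α_k`. -/
def almostDiagonalOperator {F : Type*} [Field F] {n p m : ℕ} (h : (p + 1) + m = n)
    (α : Fin p → F) (J : Matrix (Fin m) (Fin m) F) : (Fin n → F) → (Fin n → F) :=
  fun x =>
    let y : Fin (p + 1) → F := fun i => x (Fin.cast h (Fin.castAdd m i))
    let z : Fin m → F := fun i => x (Fin.cast h (Fin.natAdd (p + 1) i))
    let y' : Fin (p + 1) → F := Fin.cons (y 0 + 1) (fun i => α i * y i.succ)
    fun i => Fin.append y' (J *ᵥ z) (Fin.cast h.symm i)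

end AffineBiregular

open AffineBiregular

/-! An affine operator with a fixed point is made linear by a translation. If `f h = h g`, the chain
rule for the Jacobian matrix `M` of `h` gives `A M(x) = M(g x) C`, with `M(x)` invertible everywhere
(`exists_intertwining`). At a fixed point of `g` this is a similarity of `A` and `C`, which settles
the first case; Jordan theory, proved here over an algebraically closed field, supplies the
canonical form.

Without a fixed point, `b` lies outside the range of `A - 1`, so some linear form `l` satisfies `l
(A x) = l x` and `l b = 1`. Taking `t = l x` as a coordinate turns the operator into a shift `t ↦ t
+ 1` coupled to a linear map. Shears whose coefficients are polynomials in `t` remove the couplings,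
because `β Q(t + 1) - B Q(t) = r(t)` has a polynomial solution whenever `β ≠ 0`
(`exists_difference_eq`). Splitting off nonzero eigenvalues one at a time leaves a diagonal part and
a nilpotent part (`exists_conj_almostDiagonalOperator`). The Jordan structure belonging to nonzero
eigenvalues is thereby lost.

What survives is seen by two invariants. Iterating the intertwining relation gives `A ^ j M(x) =
M(y) C ^ j`, so the ranks of powers agree, and these determine the nilpotent part. For the spectrum,
the normal form translates a line; along it `M` becomes a polynomial matrix with `A M(t) = M(t + 1)
C`. Since `M(t + 1)` and `M(t)` differ by the action of a unipotent shift, `M(0)` carries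
generalized eigenspaces of `C` into those of `A` (`mulVec_mem_maxGenEigenspace`), so the eigenvalues
agree with multiplicity. -/

namespace AffineBiregular

/-! ### Polynomial maps and conjugacy without coordinates -/

section PolynomialMaps

variable (F : Type*) [Field F]
variable {U V W X : Type*} [AddCommGroup U] [Module F U] [AddCommGroup V] [Module F V]
  [AddCommGroup W] [Module F W] [AddCommGroup X] [Module F X]

/-- The algebra of polynomial functions on a vector space. -/
def polyFun (V : Type*) [AddCommGroup V] [Module F V] : Subalgebra F (V → F) :=
  Algebra.adjoin F (Set.range fun l : Module.Dual F V => (l : V → F))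

/-- A map between vector spaces is polynomial if its composites with linear forms are. -/
def IsPoly (φ : V → W) : Prop :=
  ∀ l : Module.Dual F W, (fun x => l (φ x)) ∈ polyFun F V

/-- Conjugacy of self-maps of possibly different vector spaces by a polynomial bijection
with polynomial inverse. -/
def PolyConj (f : V → V) (g : W → W) : Prop :=
  ∃ h : W ≃ V, IsPoly F h ∧ IsPoly F h.symm ∧ ∀ x, h (g x) = f (h x)

variable {F}

theorem dual_mem_polyFun (l : Module.Dual F V) : (fun x => l x) ∈ polyFun F V :=
  Algebra.subset_adjoin ⟨l, rfl⟩

theorem const_mem_polyFun (c : F) : (fun _ => c) ∈ polyFun F V :=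
  (polyFun F V).algebraMap_mem c

theorem IsPoly.comp_mem {φ : V → W} (hφ : IsPoly F φ) {p : W → F} (hp : p ∈ polyFun F W) :
    (fun x => p (φ x)) ∈ polyFun F V := by
  induction hp using Algebra.adjoin_induction with
  | mem p hp => obtain ⟨l, rfl⟩ := hp; exact hφ l
  | algebraMap c => exact const_mem_polyFun c
  | add p q _ _ hp hq => exact add_mem hp hq
  | mul p q _ _ hp hq => exact mul_mem hp hq

theorem IsPoly.comp {φ : V → W} {ψ : U → V} (hφ : IsPoly F φ) (hψ : IsPoly F ψ) :
    IsPoly F (fun x => φ (ψ x)) := fun l => hψ.comp_mem (hφ l)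

theorem IsPoly.linear (φ : V →ₗ[F] W) : IsPoly F (fun x => φ x) :=
  fun l => dual_mem_polyFun (l ∘ₗ φ)

theorem IsPoly.id : IsPoly F (fun x : V => x) := IsPoly.linear LinearMap.id

theorem IsPoly.const (w : W) : IsPoly F (fun _ : V => w) := fun l => const_mem_polyFun (l w)

theorem IsPoly.add {φ ψ : V → W} (hφ : IsPoly F φ) (hψ : IsPoly F ψ) :
    IsPoly F (fun x => φ x + ψ x) := fun l => by
  simp only [map_add]
  exact add_mem (hφ l) (hψ l)

theorem IsPoly.linear_comp (a : W →ₗ[F] X) {φ : V → W} (hφ : IsPoly F φ) :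
    IsPoly F (fun x => a (φ x)) := (IsPoly.linear a).comp hφ

theorem IsPoly.neg {φ : V → W} (hφ : IsPoly F φ) : IsPoly F (fun x => - φ x) :=
  hφ.linear_comp (-LinearMap.id)

theorem IsPoly.sub {φ ψ : V → W} (hφ : IsPoly F φ) (hψ : IsPoly F ψ) :
    IsPoly F (fun x => φ x - ψ x) := by
  simpa [sub_eq_add_neg] using hφ.add hψ.neg

theorem IsPoly.prodMk {φ : V → W} {ψ : V → X} (hφ : IsPoly F φ) (hψ : IsPoly F ψ) :
    IsPoly F (fun x => (φ x, ψ x)) := by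
  simpa using (hφ.linear_comp (LinearMap.inl F W X)).add (hψ.linear_comp (LinearMap.inr F W X))

theorem isPoly_fst : IsPoly F (fun x : V × W => x.1) := IsPoly.linear (LinearMap.fst F V W)

theorem isPoly_snd : IsPoly F (fun x : V × W => x.2) := IsPoly.linear (LinearMap.snd F V W)

theorem IsPoly.smul {s : V → F} {φ : V → W} (hs : IsPoly F s) (hφ : IsPoly F φ) :
    IsPoly F (fun x => s x • φ x) := fun l => by
  simp only [map_smul, smul_eq_mul]
  exact mul_mem (hs LinearMap.id) (hφ l)

theorem IsPoly.sum {ι : Type*} (s : Finset ι) {φ : ι → V → W} (h : ∀ i ∈ s, IsPoly F (φ i)) :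
    IsPoly F (fun x => ∑ i ∈ s, φ i x) := fun l => by
  simp only [map_sum]
  have := Subalgebra.sum_mem (polyFun F V) (t := s) (f := fun i x => l (φ i x)) fun i hi => h i hi l
  convert this using 1
  ext x
  simp

theorem isPoly_pi_iff {ι : Type*} [Fintype ι] {φ : V → ι → F} :
    IsPoly F φ ↔ ∀ i, (fun x => φ x i) ∈ polyFun F V := by
  classical
  refine ⟨fun h i => h (LinearMap.proj i), fun h => ?_⟩
  have : φ = fun x => ∑ i, φ x i • (Pi.single i 1 : ι → F) := by
    ext x j
    simp [Finset.sum_apply, Pi.single_apply]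
  rw [this]
  refine IsPoly.sum _ fun i _ => IsPoly.smul (fun l => ?_) (IsPoly.const _)
  have e : (fun x => l (φ x i)) = (fun x => l 1) * (fun x => φ x i) := by
    ext x
    simpa [mul_comm] using l.map_smul (φ x i) 1
  rw [e]
  exact mul_mem (const_mem_polyFun _) (h i)

theorem mem_polyFun_pi_iff {n : ℕ} {p : (Fin n → F) → F} :
    p ∈ polyFun F (Fin n → F) ↔ ∃ P : MvPolynomial (Fin n) F, ∀ x, p x = MvPolynomial.eval x P := by
  constructor
  · intro hp
    induction hp using Algebra.adjoin_induction with
    | mem p hp =>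
      obtain ⟨l, rfl⟩ := hp
      refine ⟨∑ i, MvPolynomial.C (l (Pi.single i 1)) * MvPolynomial.X i, fun x => ?_⟩
      conv_lhs => rw [← Finset.univ_sum_single x]
      simp only [map_sum, map_mul, MvPolynomial.eval_C, MvPolynomial.eval_X]
      refine Finset.sum_congr rfl fun i _ => ?_
      have := l.map_smul (x i) (Pi.single i 1)
      rw [← Pi.single_smul] at this
      simpa [mul_comm] using this
    | algebraMap c => exact ⟨MvPolynomial.C c, fun x => by simp⟩
    | add p q _ _ hp hq =>
      obtain ⟨P, hP⟩ := hp
      obtain ⟨Q, hQ⟩ := hq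
      exact ⟨P + Q, fun x => by simp [hP, hQ]⟩
    | mul p q _ _ hp hq =>
      obtain ⟨P, hP⟩ := hp
      obtain ⟨Q, hQ⟩ := hq
      exact ⟨P * Q, fun x => by simp [hP, hQ]⟩
  · rintro ⟨P, hP⟩
    obtain rfl : p = fun x => MvPolynomial.eval x P := funext hP
    clear hP
    induction P using MvPolynomial.induction_on with
    | C c => simpa using const_mem_polyFun c
    | add P Q hP hQ =>
      simp only [map_add]
      exact add_mem hP hQ
    | mul_X P i hP =>
      simp only [map_mul, MvPolynomial.eval_X]
      exact mul_mem hP (dual_mem_polyFun (LinearMap.proj i : Module.Dual F (Fin n → F)))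

theorem isPoly_iff_isPolynomialMap {n : ℕ} {h : (Fin n → F) → (Fin n → F)} :
    IsPoly F h ↔ IsPolynomialMap h := by
  simp only [isPoly_pi_iff, mem_polyFun_pi_iff, IsPolynomialMap]
  rw [Classical.skolem]
  exact ⟨fun ⟨p, hp⟩ => ⟨p, fun x i => hp i x⟩, fun ⟨p, hp⟩ => ⟨p, fun i x => hp x i⟩⟩

/-- The bridge to the coordinate-free notion, in which the intermediate operators may act on
products and on kernels of linear forms. -/
theorem biregularlyConjugate_iff {n : ℕ} {f g : (Fin n → F) → (Fin n → F)} :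
    BiregularlyConjugate f g ↔ PolyConj F f g := by
  simp only [BiregularlyConjugate, PolyConj, IsBiregular, ← isPoly_iff_isPolynomialMap,
    Equiv.eq_symm_apply, and_assoc]

theorem PolyConj.refl (f : V → V) : PolyConj F f f :=
  ⟨Equiv.refl _, IsPoly.id, IsPoly.id, fun _ => rfl⟩

theorem PolyConj.symm {f : V → V} {g : W → W} : PolyConj F f g → PolyConj F g f :=
  fun ⟨h, h1, h2, h3⟩ => ⟨h.symm, h2, h1, fun x => by
    rw [Equiv.symm_apply_eq, h3, Equiv.apply_symm_apply]⟩

theorem PolyConj.trans {f : U → U} {g : V → V} {k : W → W} :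
    PolyConj F f g → PolyConj F g k → PolyConj F f k :=
  fun ⟨h, h1, h2, h3⟩ ⟨h', h1', h2', h3'⟩ =>
    ⟨h'.trans h, h1.comp h1', h2'.comp h2, fun x => by simp [h3, h3']⟩

theorem PolyConj.of_linearEquiv {f : V → V} {g : W → W} (e : V ≃ₗ[F] W)
    (h : ∀ x, e (f x) = g (e x)) : PolyConj F f g :=
  PolyConj.symm ⟨e.toEquiv, IsPoly.linear e.toLinearMap, IsPoly.linear e.symm.toLinearMap, h⟩

theorem PolyConj.of_translation {f g : V → V} (v : V) (h : ∀ x, g x + v = f (x + v)) :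
    PolyConj F f g :=
  ⟨Equiv.addRight v, IsPoly.id.add (IsPoly.const v), by
    simpa [sub_eq_add_neg] using IsPoly.id.sub (IsPoly.const (F := F) v), h⟩

theorem PolyConj.prodMap {f : V → V} {g : W → W} (k : X → X) :
    PolyConj F f g → PolyConj F (Prod.map k f) (Prod.map k g) :=
  fun ⟨h, h1, h2, h3⟩ => ⟨(Equiv.refl X).prodCongr h, isPoly_fst.prodMk (h1.comp isPoly_snd),
    isPoly_fst.prodMk (h2.comp isPoly_snd), fun x => Prod.ext rfl (h3 x.2)⟩

/-- Conjugation by the shear `(x, y) ↦ (x, y + φ x)`. -/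
theorem PolyConj.of_shear {f g : V × W → V × W} {φ : V → W} (hφ : IsPoly F φ)
    (h : ∀ x y, f (x, y + φ x) = ((g (x, y)).1, (g (x, y)).2 + φ (g (x, y)).1)) :
    PolyConj F f g :=
  ⟨{ toFun := fun p => (p.1, p.2 + φ p.1)
     invFun := fun p => (p.1, p.2 - φ p.1)
     left_inv := fun p => by simp
     right_inv := fun p => by simp },
   isPoly_fst.prodMk (isPoly_snd.add (hφ.comp isPoly_fst)),
   isPoly_fst.prodMk (isPoly_snd.sub (hφ.comp isPoly_fst)), fun p => (h p.1 p.2).symm⟩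

end PolynomialMaps

/-! ### Polynomial solutions of linear difference equations -/

section DifferenceEquation

open Polynomial

variable {F : Type*} [Field F]

theorem mem_polyFun_self_iff {p : F → F} : p ∈ polyFun F F ↔ ∃ P : F[X], ∀ t, p t = P.eval t := by
  constructor
  · intro hp
    induction hp using Algebra.adjoin_induction with
    | mem p hp =>
      obtain ⟨l, rfl⟩ := hp
      refine ⟨C (l 1) * X, fun t => ?_⟩
      have h := l.map_smul t 1
      rw [smul_eq_mul, mul_one, smul_eq_mul] at h
      show l t = _
      rw [eval_mul, eval_C, eval_X, h, mul_comm]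
    | algebraMap c => exact ⟨C c, fun x => by simp⟩
    | add p q _ _ hp hq =>
      obtain ⟨P, hP⟩ := hp
      obtain ⟨Q, hQ⟩ := hq
      exact ⟨P + Q, fun x => by simp [hP, hQ]⟩
    | mul p q _ _ hp hq =>
      obtain ⟨P, hP⟩ := hp
      obtain ⟨Q, hQ⟩ := hq
      exact ⟨P * Q, fun x => by simp [hP, hQ]⟩
  · rintro ⟨P, hP⟩
    obtain rfl : p = fun x => P.eval x := funext hP
    clear hP
    induction P using Polynomial.induction_on' with
    | add P Q hP hQ =>
      simp only [eval_add]
      exact add_mem hP hQ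
    | monomial n a =>
      simp only [eval_monomial]
      exact mul_mem (const_mem_polyFun a)
        (pow_mem (dual_mem_polyFun (LinearMap.id : Module.Dual F F)) n)

/-- Induction on a degree bound: a monomial `q` cancels the top coefficient of `p`. -/
theorem exists_comp_X_add_one_eq [CharZero F] {β : F} (hβ : β ≠ 0) (b : F) (p : F[X]) :
    ∃ q : F[X], C β * q.comp (X + 1) - C b * q = p := by
  suffices H : ∀ (d : ℕ) (p : F[X]), p.degree < d →
      ∃ q : F[X], C β * q.comp (X + 1) - C b * q = p from
    H (p.natDegree + 1) p (degree_lt_iff_coeff_zero _ _ |>.2 fun m hm =>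
      coeff_eq_zero_of_natDegree_lt hm)
  intro d
  induction d with
  | zero =>
    intro p hp
    exact ⟨0, by simp [degree_eq_bot.1 (Nat.WithBot.lt_zero_iff.1 hp)]⟩
  | succ d ih =>
    intro p hp
    suffices H : ∃ q : F[X], (p - (C β * q.comp (X + 1) - C b * q)).degree < d by
      obtain ⟨q, hq⟩ := H
      obtain ⟨q', hq'⟩ := ih _ hq
      refine ⟨q' + q, ?_⟩
      rw [add_comp]
      linear_combination hq'
    rw [degree_lt_iff_coeff_zero] at hp
    have hd : (d : F) + 1 ≠ 0 := by exact_mod_cast d.succ_ne_zero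
    -- In the resonant case the operator lowers degrees by one and sends `X ^ (d + 1)` to leading
    -- term `β (d + 1) X ^ d`, which is where characteristic zero enters. Otherwise it keeps the
    -- degree and multiplies the leading coefficient by `β - b`.
    by_cases h : β = b
    · subst h
      refine ⟨C (p.coeff d / (β * (d + 1))) * X ^ (d + 1), ?_⟩
      rw [degree_lt_iff_coeff_zero]
      intro m hm
      simp only [mul_comp, C_comp, pow_comp, X_comp, coeff_sub, coeff_C_mul, coeff_X_add_one_pow,
        coeff_X_pow]
      rcases hm.eq_or_lt with rfl | hm
      · simp
        field_simp
        ring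
      · rw [hp m hm]
        rcases (Nat.succ_le_of_lt hm).eq_or_lt with rfl | hm
        · simp
        · rw [Nat.choose_eq_zero_of_lt hm, if_neg (by omega)]
          simp
    · have hb : β - b ≠ 0 := sub_ne_zero.2 h
      refine ⟨C (p.coeff d / (β - b)) * X ^ d, ?_⟩
      rw [degree_lt_iff_coeff_zero]
      intro m hm
      simp only [mul_comp, C_comp, pow_comp, X_comp, coeff_sub, coeff_C_mul, coeff_X_add_one_pow,
        coeff_X_pow]
      rcases hm.eq_or_lt with rfl | hm
      · simp
        field_simp
        ring
      · rw [hp m hm, Nat.choose_eq_zero_of_lt hm, if_neg (by omega)]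
        simp

/-- For commuting elements `a ^ n - b ^ n` is a multiple of `a - b`, hence so is `p(a) - p(b)`. -/
theorem exists_aeval_eq_sub_mul {R : Type*} [Ring R] [Algebra F R] {a b : R}
    (h : Commute a b) (p : F[X]) (hp : aeval b p = 0) : ∃ r, aeval a p = (a - b) * r := by
  suffices H : ∃ r, aeval a p - aeval b p = (a - b) * r by rwa [hp, sub_zero] at H
  clear hp
  induction p using Polynomial.induction_on' with
  | add p q hp hq =>
    obtain ⟨r, hr⟩ := hp
    obtain ⟨s, hs⟩ := hq
    exact ⟨r + s, by rw [mul_add, ← hr, ← hs, map_add, map_add]; abel⟩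
  | monomial n c =>
    refine ⟨c • ∑ i ∈ Finset.range n, a ^ i * b ^ (n - 1 - i), ?_⟩
    rw [aeval_monomial, aeval_monomial, mul_smul_comm, h.mul_geom_sum₂, ← mul_sub,
      Algebra.smul_def]

variable (F) in
/-- Polynomial curves in a vector space. -/
def polyCurves (V : Type*) [AddCommGroup V] [Module F V] : Submodule F (F → V) where
  carrier := {φ | IsPoly F φ}
  add_mem' := IsPoly.add
  zero_mem' := IsPoly.const 0
  smul_mem' c φ h := by
    show IsPoly F fun x => c • φ x
    exact IsPoly.linear_comp (c • LinearMap.id) h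

variable {V : Type*} [AddCommGroup V] [Module F V]

/-- The translation `φ ↦ (t ↦ φ (t + 1))` of polynomial curves. -/
def curveShift : Module.End F (polyCurves F V) :=
  (LinearMap.funLeft F V fun t : F => t + 1).restrict (p := polyCurves F V)
    (q := polyCurves F V) fun φ h =>
      IsPoly.comp (U := F) (φ := φ) h (IsPoly.id.add (IsPoly.const 1))

/-- Postcomposition of polynomial curves with a linear map. -/
def curvePost (B : Module.End F V) : Module.End F (polyCurves F V) :=
  (B.compLeft F).restrict (p := polyCurves F V) (q := polyCurves F V) fun _ h => IsPoly.linear_comp B h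

theorem curvePost_apply (B : Module.End F V) (φ : polyCurves F V) (t : F) :
    (curvePost B φ : F → V) t = B ((φ : F → V) t) := rfl

theorem aeval_curvePost_apply (B : Module.End F V) (p : F[X]) (φ : polyCurves F V) (t : F) :
    (aeval (curvePost B) p φ : F → V) t = aeval B p ((φ : F → V) t) := by
  induction p using Polynomial.induction_on' with
  | add p q hp hq => simp [hp, hq]
  | monomial n c =>
    simp only [aeval_monomial, ← Algebra.smul_def, LinearMap.smul_apply]
    show c • (((curvePost B) ^ n) φ : F → V) t = _
    congr 1
    induction n generalizing φ with
    | zero => rfl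
    | succ n ih => rw [pow_succ, pow_succ, Module.End.mul_apply, ih, curvePost_apply]; rfl

/-- Coordinates in a basis decouple the equation into scalar ones. -/
theorem curveShift_sub_surjective [CharZero F] [FiniteDimensional F V] {β : F} (hβ : β ≠ 0)
    (b : F) : Function.Surjective
      (β • curveShift (F := F) (V := V) - algebraMap F (Module.End F (polyCurves F V)) b) := by
  intro φ
  let e := Module.finBasis F V
  have h : ∀ i, ∃ P : F[X], ∀ t, e.coord i (φ.1 t) = P.eval t := fun i =>
    mem_polyFun_self_iff.1 (φ.2 (e.coord i))
  choose P hP using h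
  choose Q hQ using fun i => exists_comp_X_add_one_eq hβ b (P i)
  refine ⟨⟨fun t => ∑ i, (Q i).eval t • e i, IsPoly.sum _ fun i _ =>
    IsPoly.smul (fun l => ?_) (IsPoly.const _)⟩, ?_⟩
  · exact mem_polyFun_self_iff.2 ⟨C (l 1) * Q i, fun t => by
      simpa [mul_comm] using l.map_smul ((Q i).eval t) 1⟩
  · ext t
    show β • (∑ i, (Q i).eval (t + 1) • e i) - b • (∑ i, (Q i).eval t • e i) = φ.1 t
    rw [← e.sum_repr (φ.1 t), Finset.smul_sum, Finset.smul_sum, ← Finset.sum_sub_distrib]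
    refine Finset.sum_congr rfl fun i _ => ?_
    have := congrArg (Polynomial.eval t) (hQ i)
    rw [← hP i t] at this
    simp only [eval_sub, eval_mul, eval_C, eval_comp, eval_add, eval_X, eval_one,
      Module.Basis.coord_apply] at this
    rw [← this, sub_smul, mul_smul, mul_smul]

/-- If `p` is the split polynomial killing `B`, then `p(S)` is a composite of surjections and
factors as `(S - B) r`. This passes from scalar coefficients to an operator coefficient without
triangularizing it. -/
theorem surjective_sub_of_aeval_eq_zero {E : Type*} [AddCommGroup E] [Module F E]
    {S B : Module.End F E} (h : Commute S B)
    (hS : ∀ b : F, Function.Surjective (S - algebraMap F (Module.End F E) b)) (s : Multiset F)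
    (hs : aeval B ((s.map fun b => X - C b).prod) = 0) : Function.Surjective (S - B) := by
  have H : ∀ s : Multiset F, Function.Surjective (aeval S ((s.map fun b => X - C b).prod)) := by
    intro s
    induction s using Multiset.induction with
    | empty =>
      rw [Multiset.map_zero, Multiset.prod_zero, map_one]
      exact Function.surjective_id
    | cons b s ih =>
      rw [Multiset.map_cons, Multiset.prod_cons, map_mul, map_sub, aeval_X, aeval_C]
      exact (hS b).comp ih
  obtain ⟨r, hr⟩ := exists_aeval_eq_sub_mul h _ hs
  have := H s
  rw [hr] at this
  exact Function.Surjective.of_comp this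

/-- The vector difference equation `β Q(t + 1) - B Q(t) = r(t)` has a polynomial solution. -/
theorem exists_difference_eq [IsAlgClosed F] [CharZero F] [FiniteDimensional F V] {β : F}
    (hβ : β ≠ 0) (B : Module.End F V) {r : F → V} (hr : IsPoly F r) :
    ∃ Q : F → V, IsPoly F Q ∧ ∀ t, β • Q (t + 1) - B (Q t) = r t := by
  suffices H : Function.Surjective (β • curveShift (F := F) (V := V) - curvePost B) by
    obtain ⟨Q, hQ⟩ := H ⟨r, hr⟩
    exact ⟨Q.1, Q.2, fun t => congrFun (congrArg Subtype.val hQ) t⟩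
  have hcomm : Commute (β • curveShift (F := F) (V := V)) (curvePost B) := by
    refine Commute.smul_left ?_ β
    ext φ t
    rfl
  -- The annihilating polynomial is the characteristic polynomial of `B`: it splits, and
  -- Cayley–Hamilton holds pointwise along curves.
  refine surjective_sub_of_aeval_eq_zero hcomm (curveShift_sub_surjective hβ) B.charpoly.roots ?_
  have hroots : (B.charpoly.roots.map fun b => X - C b).prod = B.charpoly := by
    have := (IsAlgClosed.splits B.charpoly).eq_prod_roots
    rw [LinearMap.charpoly_monic B, C_1, one_mul] at this
    exact this.symm
  ext φ t
  rw [hroots, aeval_curvePost_apply, LinearMap.aeval_self_charpoly]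
  rfl

end DifferenceEquation

/-! ### Conjugacy invariants from the Jacobian matrix -/

section Invariants

open MvPolynomial

variable {F : Type*} [Field F] {n : ℕ}

/-- The Jacobian matrix of a tuple of polynomials. -/
noncomputable def jacobian (P : Fin n → MvPolynomial (Fin n) F) :
    Matrix (Fin n) (Fin n) (MvPolynomial (Fin n) F) :=
  Matrix.of fun i j => pderiv j (P i)

/-- The polynomials describing an affine operator. -/
noncomputable def affinePoly (A : Matrix (Fin n) (Fin n) F) (b : Fin n → F) (i : Fin n) :
    MvPolynomial (Fin n) F :=
  ∑ j, C (A i j) * X j + C (b i)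

theorem eval_affinePoly (A : Matrix (Fin n) (Fin n) F) (b x : Fin n → F) (i : Fin n) :
    eval x (affinePoly A b i) = affineOperator A b x i := by
  simp [affinePoly, affineOperator, Matrix.mulVec, dotProduct]

theorem jacobian_affinePoly (A : Matrix (Fin n) (Fin n) F) (b x : Fin n → F) :
    (jacobian (affinePoly A b)).map (eval x) = A := by
  ext i j
  simp [jacobian, affinePoly, pderiv_X, Pi.single_apply, Derivation.leibniz]

theorem pderiv_bind₁ (Q : Fin n → MvPolynomial (Fin n) F) (j : Fin n)
    (P : MvPolynomial (Fin n) F) :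
    pderiv j (bind₁ Q P) = ∑ i, bind₁ Q (pderiv i P) * pderiv j (Q i) := by
  induction P using MvPolynomial.induction_on with
  | C c => simp
  | add P R hP hR => simp [hP, hR, add_mul, Finset.sum_add_distrib]
  | mul_X P k hP =>
    simp only [map_mul, bind₁_X_right, Derivation.leibniz, hP, smul_eq_mul, map_add, add_mul,
      Finset.sum_add_distrib, pderiv_X, Pi.single_apply]
    congr 1
    · simp [apply_ite (bind₁ Q)]
    · rw [Finset.mul_sum]
      exact Finset.sum_congr rfl fun i _ => by ring

theorem eval_bind₁ (Q : Fin n → MvPolynomial (Fin n) F) (P : MvPolynomial (Fin n) F)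
    (x : Fin n → F) : eval x (bind₁ Q P) = eval (fun k => eval x (Q k)) P := by
  induction P using MvPolynomial.induction_on with
  | C c => simp
  | add P R hP hR => simp only [map_add, hP, hR]
  | mul_X P k hP => simp only [map_mul, bind₁_X_right, eval_X, hP]

/-- The chain rule. The hypothesis only equates functions; over an infinite field this forces
equality of polynomials, which can then be differentiated. -/
theorem jacobian_comp [Infinite F] {P Q R : Fin n → MvPolynomial (Fin n) F}
    (h : ∀ x i, eval (fun k => eval x (Q k)) (P i) = eval x (R i)) (x : Fin n → F) :
    (jacobian P).map (eval fun k => eval x (Q k)) * (jacobian Q).map (eval x) =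
      (jacobian R).map (eval x) := by
  ext i j
  have hR : R i = bind₁ Q (P i) := MvPolynomial.funext fun y => by rw [eval_bind₁, h]
  simp only [Matrix.mul_apply, Matrix.map_apply, jacobian, Matrix.of_apply, hR, pderiv_bind₁,
    map_sum, map_mul, eval_bind₁]

theorem exists_intertwining [Infinite F] {A C : Matrix (Fin n) (Fin n) F} {b d : Fin n → F}
    (h : BiregularlyConjugate (affineOperator A b) (affineOperator C d)) :
    ∃ M : Matrix (Fin n) (Fin n) (MvPolynomial (Fin n) F), (∀ x, IsUnit (M.map (eval x))) ∧
      ∀ x, A * M.map (eval x) = M.map (eval (affineOperator C d x)) * C := by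
  obtain ⟨h, ⟨⟨P, hP⟩, Q, hQ⟩, hc⟩ := h
  simp only [] at hP hQ
  have hP' : ∀ x, (fun k => eval x (P k)) = h x := fun x => funext fun k => (hP x k).symm
  have hQ' : ∀ x, (fun k => eval x (Q k)) = h.symm x := fun x => funext fun k => (hQ x k).symm
  refine ⟨jacobian P, fun x => ?_, fun x => ?_⟩
  -- Differentiating `h⁻¹ h = id` shows that the Jacobian matrix is invertible at every point.
  · have := jacobian_comp (P := Q) (Q := P) (R := affinePoly 1 0) (fun x i => by
      rw [hP', ← hQ, eval_affinePoly]
      simp [affineOperator]) x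
    rw [jacobian_affinePoly] at this
    exact IsUnit.of_mul_eq_one_right _ this
  -- The same composite is differentiated as `f ∘ h` and as `h ∘ g`.
  · have h1 := jacobian_comp (P := affinePoly A b) (Q := P)
      (R := fun i => bind₁ P (affinePoly A b i)) (fun x i => (eval_bind₁ _ _ _).symm) x
    have h2 := jacobian_comp (P := P) (Q := affinePoly C d)
      (R := fun i => bind₁ P (affinePoly A b i)) (fun x i => by
        rw [eval_bind₁, hP', eval_affinePoly]
        simp only [eval_affinePoly]
        show eval (affineOperator C d x) (P i) = _
        rw [← hP, hc, Equiv.apply_symm_apply]) x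
    simp only [eval_affinePoly, jacobian_affinePoly] at h1 h2
    rw [h1, ← h2]

theorem SimilarMatrix.of_mul_eq {A C M : Matrix (Fin n) (Fin n) F} (hM : IsUnit M)
    (h : A * M = M * C) : SimilarMatrix A C := by
  have hd := (Matrix.isUnit_iff_isUnit_det M).1 hM
  refine ⟨M⁻¹, (Matrix.isUnit_nonsing_inv_iff).2 hM, ?_⟩
  rw [Matrix.nonsing_inv_nonsing_inv _ hd, ← h, Matrix.mul_assoc, Matrix.mul_nonsing_inv _ hd,
    Matrix.mul_one]

/-- At a fixed point of the second operator the two Jacobian matrices in the intertwining relation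
coincide. -/
theorem similarMatrix_of_fixedPoint [Infinite F] {A C : Matrix (Fin n) (Fin n) F} {b d : Fin n → F}
    (hC : HasFixedPoint (affineOperator C d))
    (h : BiregularlyConjugate (affineOperator A b) (affineOperator C d)) : SimilarMatrix A C := by
  obtain ⟨M, hM, hMC⟩ := exists_intertwining h
  obtain ⟨x, hx⟩ := hC
  have := hMC x
  rw [hx] at this
  exact SimilarMatrix.of_mul_eq (hM x) this

theorem rank_pow_eq_of_biregularlyConjugate [Infinite F] {A C : Matrix (Fin n) (Fin n) F}
    {b d : Fin n → F} (h : BiregularlyConjugate (affineOperator A b) (affineOperator C d)) (j : ℕ) :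
    (A ^ j).rank = (C ^ j).rank := by
  obtain ⟨M, hM, hMC⟩ := exists_intertwining h
  -- Here `y` is the `j`-th iterate of `x`; only its existence matters, since both Jacobian factors
  -- are invertible.
  have key : ∀ x, ∃ y, A ^ j * M.map (eval x) = M.map (eval y) * C ^ j := by
    induction j with
    | zero => exact fun x => ⟨x, by simp⟩
    | succ j ih =>
      intro x
      obtain ⟨y, hy⟩ := ih (affineOperator C d x)
      exact ⟨y, by rw [pow_succ, Matrix.mul_assoc, hMC, ← Matrix.mul_assoc, hy, Matrix.mul_assoc,
        ← pow_succ]⟩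
  obtain ⟨y, hy⟩ := key 0
  have hx := (Matrix.isUnit_iff_isUnit_det _).1 (hM 0)
  have hy' := (Matrix.isUnit_iff_isUnit_det _).1 (hM y)
  rw [← Matrix.rank_mul_eq_left_of_isUnit_det _ (A ^ j) hx, hy,
    Matrix.rank_mul_eq_right_of_isUnit_det _ (C ^ j) hy']

/-- The values of a polynomial curve `t ↦ M(t) v` such that `A M(t) = M(t + 1) C` lie in the
generalized eigenspace of `A`, if `v` is a generalized eigenvector of `C`. -/
theorem mulVec_mem_maxGenEigenspace {A C : Matrix (Fin n) (Fin n) F}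
    {M : Matrix (Fin n) (Fin n) (Polynomial F)}
    (h : ∀ t, A * M.map (Polynomial.eval t) = M.map (Polynomial.eval (t + 1)) * C) {μ : F}
    {v : Fin n → F} (hv : v ∈ Module.End.maxGenEigenspace C.mulVecLin μ) :
    M.map (Polynomial.eval 0) *ᵥ v ∈ Module.End.maxGenEigenspace A.mulVecLin μ := by
  let S : Module.End F (F → Fin n → F) := LinearMap.funLeft F _ fun t => t + 1
  let R : Module.End F (F → Fin n → F) := LinearMap.funLeft F _ fun t => t - 1
  -- Applying `A` and shifting back: by the relation `h`, the map `Φ` intertwines `C` with `T`, so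
  -- `T - μ` is nilpotent on `Φ v`.
  let T : Module.End F (F → Fin n → F) := R * A.mulVecLin.compLeft F
  let Φ : (Fin n → F) →ₗ[F] (F → Fin n → F) :=
    LinearMap.pi fun t => (M.map (Polynomial.eval t)).mulVecLin
  have hΦ : ∀ w, T (Φ w) = Φ (C *ᵥ w) := fun w => by
    funext t
    show A *ᵥ (M.map (Polynomial.eval (t - 1)) *ᵥ w) = M.map (Polynomial.eval t) *ᵥ (C *ᵥ w)
    rw [Matrix.mulVec_mulVec, h, sub_add_cancel, ← Matrix.mulVec_mulVec]
  have hpow : ∀ (k : ℕ) w, ((T - μ • 1) ^ k) (Φ w) = Φ (((C.mulVecLin - μ • 1) ^ k) w) := by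
    intro k
    induction k with
    | zero => exact fun w => rfl
    | succ k ih =>
      intro w
      rw [pow_succ, pow_succ, Module.End.mul_apply, Module.End.mul_apply, ← ih]
      congr 1
      simp [hΦ]
  obtain ⟨k, hk⟩ := (Module.End.mem_maxGenEigenspace _ _ _).1 hv
  have hT : ((T - μ • 1) ^ k) (Φ v) = 0 := by rw [hpow, hk, map_zero]
  have hTS : Commute T S := by
    ext x t i
    simp [T, S, R, LinearMap.funLeft]
  -- Pointwise application of `A` is `T * S`, so `A - μ` is a sum of two commuting operators, each
  -- killing `Φ v` after enough iterations.
  have hA : A.mulVecLin.compLeft F - μ • 1 = (T - μ • 1) * S + μ • (S - 1) := by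
    have : T * S = A.mulVecLin.compLeft F := by
      refine LinearMap.ext fun w => funext fun t => ?_
      show A *ᵥ (w (t - 1 + 1)) = A *ᵥ w t
      rw [sub_add_cancel]
    rw [sub_mul, this, smul_mul_assoc, one_mul, smul_sub]
    abel
  -- `S - 1` is the forward difference, and the coordinates of `Φ v` are polynomials of bounded
  -- degree.
  have hS : ∃ D : ℕ, ((S - 1) ^ D) (Φ v) = 0 := by
    have h1 : ∀ (D : ℕ) w t i, ((S - 1) ^ D) w t i = (fwdDiff (1 : F))^[D] (fun t => w t i) t := by
      intro D
      induction D with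
      | zero => exact fun w t i => rfl
      | succ D ih =>
        intro w t i
        rw [pow_succ, Module.End.mul_apply, ih, Function.iterate_succ_apply]
        rfl
    let p : Fin n → Polynomial F := fun i => ∑ j, M i j * Polynomial.C (v j)
    have hp : ∀ t i, Φ v t i = (p i).eval t := fun t i => by
      simp [Φ, p, Polynomial.eval_finsetSum, Matrix.mulVec, dotProduct]
    refine ⟨(∑ i, (p i).natDegree) + 1, ?_⟩
    funext t i
    rw [h1]
    simp only [hp]
    have := Polynomial.fwdDiff_iter_eq_zero_of_degree_lt (P := p i)
      (n := (∑ i, (p i).natDegree) + 1) (Nat.lt_succ_of_le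
        (Finset.single_le_sum (f := fun i => (p i).natDegree) (fun _ _ => Nat.zero_le _)
          (Finset.mem_univ i)))
    exact congrFun this t
  obtain ⟨D, hD⟩ := hS
  have c1 : Commute (T - μ • 1) S := hTS.sub_left (by
    rw [← Algebra.algebraMap_eq_smul_one]; exact Algebra.commutes μ S)
  have c2 : Commute ((T - μ • 1) * S) (μ • (S - 1)) :=
    Commute.smul_right (Commute.mul_left (c1.sub_right (Commute.one_right _))
      ((Commute.refl S).sub_right (Commute.one_right S))) μ
  have hmem := Module.End.genEigenspace_inf_le_add _ _ 0 0 ⊤ ⊤ c2 (x := Φ v)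
    ⟨(Module.End.mem_maxGenEigenspace _ _ _).2 ⟨k, by
      rw [zero_smul, sub_zero, c1.mul_pow, (c1.pow_pow k k).eq, Module.End.mul_apply, hT,
        map_zero]⟩,
      (Module.End.mem_maxGenEigenspace _ _ _).2 ⟨D, by
      rw [zero_smul, sub_zero, smul_pow, LinearMap.smul_apply, hD, smul_zero]⟩⟩
  rw [← hA, add_zero, top_add] at hmem
  obtain ⟨N, hN⟩ := (Module.End.mem_maxGenEigenspace _ _ _).1 hmem
  rw [zero_smul, sub_zero] at hN
  refine (Module.End.mem_maxGenEigenspace _ _ _).2 ⟨N, ?_⟩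
  have h2 : ∀ (N : ℕ) w t, ((A.mulVecLin.compLeft F - μ • 1) ^ N) w t =
      ((A.mulVecLin - μ • 1) ^ N) (w t) := by
    intro N
    induction N with
    | zero => exact fun w t => rfl
    | succ N ih =>
      intro w t
      rw [pow_succ, pow_succ, Module.End.mul_apply, Module.End.mul_apply, ih]
      rfl
  have := h2 N (Φ v) 0
  rw [hN] at this
  exact this.symm

theorem charpoly_roots_eq_of_biregularlyConjugate [IsAlgClosed F] {A C : Matrix (Fin n) (Fin n) F}
    {b d : Fin n → F} (h : BiregularlyConjugate (affineOperator A b) (affineOperator C d))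
    (x₀ e : Fin n → F) (hline : ∀ t : F, affineOperator C d (x₀ + t • e) = x₀ + (t + 1) • e) :
    A.charpoly.roots = C.charpoly.roots := by
  have : Infinite F := IsAlgClosed.instInfinite
  obtain ⟨M, hM, hMC⟩ := exists_intertwining h
  -- The Jacobian matrix restricted to the translated line is polynomial in the parameter `t`.
  let N : Matrix (Fin n) (Fin n) (Polynomial F) :=
    M.map (aeval fun k => Polynomial.C (x₀ k) + Polynomial.X * Polynomial.C (e k))
  have hN : ∀ t, N.map (Polynomial.eval t) = M.map (eval (x₀ + t • e)) := by
    intro t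
    ext i j
    simp only [N, Matrix.map_apply]
    induction M i j using MvPolynomial.induction_on with
    | C c => simp
    | add p q hp hq => rw [map_add, Polynomial.eval_add, hp, hq, map_add]
    | mul_X p k hp =>
      rw [map_mul, Polynomial.eval_mul, hp, map_mul]
      congr 1
      rw [aeval_X, eval_X]
      simp [mul_comm (e k) t]
  have key : ∀ t, A * N.map (Polynomial.eval t) = N.map (Polynomial.eval (t + 1)) * C := by
    intro t
    rw [hN, hN, hMC, hline]
  have h0 : IsUnit (N.map (Polynomial.eval 0)) := by rw [hN]; exact hM _
  have hle : C.charpoly.roots ≤ A.charpoly.roots := by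
    classical
    rw [Multiset.le_iff_count]
    intro μ
    rw [Polynomial.count_roots, Polynomial.count_roots, ← Matrix.charpoly_toLin',
      ← Matrix.charpoly_toLin', ← LinearMap.finrank_maxGenEigenspace_eq,
      ← LinearMap.finrank_maxGenEigenspace_eq, Matrix.toLin'_apply', Matrix.toLin'_apply']
    have hinj := Matrix.mulVec_injective_of_isUnit h0
    rw [LinearEquiv.finrank_eq
      (Submodule.equivMapOfInjective (N.map (Polynomial.eval 0)).mulVecLin hinj _)]
    refine Submodule.finrank_mono ?_
    rintro _ ⟨v, hv, rfl⟩
    exact mulVec_mem_maxGenEigenspace key hv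
  -- One inclusion suffices: both multisets have `n` elements.
  refine (Multiset.eq_of_le_of_card_le hle ?_).symm
  rw [IsAlgClosed.card_roots_eq_natDegree, IsAlgClosed.card_roots_eq_natDegree,
    Matrix.charpoly_natDegree_eq_dim, Matrix.charpoly_natDegree_eq_dim]

end Invariants

/-! ### Reduction to the almost diagonal form -/

section NormalForm

variable {F : Type*} [Field F]

/-- The splitting of a vector space by a linear form `l` and a vector `v` with `l v = 1`. -/
def splitEquiv {V : Type*} [AddCommGroup V] [Module F V] (l : Module.Dual F V) {v : V}
    (hv : l v = 1) : V ≃ₗ[F] F × LinearMap.ker l where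
  toFun x := (l x, ⟨x - l x • v, by simp [hv]⟩)
  invFun y := y.1 • v + y.2
  map_add' x y := Prod.ext (map_add l x y) (Subtype.ext (by
    show x + y - l (x + y) • v = x - l x • v + (y - l y • v)
    rw [map_add, add_smul]; abel))
  map_smul' a x := Prod.ext (map_smul l a x) (Subtype.ext (by
    show a • x - l (a • x) • v = a • (x - l x • v)
    rw [map_smul, smul_sub, smul_assoc]))
  left_inv x := by simp
  right_inv y := by
    have h : l (y.1 • v + (y.2 : V)) = y.1 := by simp [hv]
    exact Prod.ext h (Subtype.ext (by show _ - l (y.1 • v + (y.2 : V)) • v = _; rw [h, add_sub_cancel_left]))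

theorem finrank_ker_add_one {V : Type*} [AddCommGroup V] [Module F V] [FiniteDimensional F V]
    (l : Module.Dual F V) {v : V} (hv : l v = 1) :
    Module.finrank F (LinearMap.ker l) + 1 = Module.finrank F V := by
  rw [(splitEquiv l hv).finrank_eq, Module.finrank_prod, Module.finrank_self, add_comm]

theorem isNilpotent_of_forall_surjective [IsAlgClosed F] {V : Type*} [AddCommGroup V] [Module F V]
    [FiniteDimensional F V] (B : Module.End F V)
    (h : ∀ β : F, β ≠ 0 → LinearMap.range (B - β • 1) = ⊤) : IsNilpotent B := by
  have h0 : ∀ β ∈ B.charpoly.roots, β = 0 := by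
    intro β hβ
    by_contra hne
    have h1 : B.HasEigenvalue β := (Module.End.hasEigenvalue_iff_isRoot_charpoly B β).2
      (Polynomial.isRoot_of_mem_roots hβ)
    obtain ⟨v, hv⟩ := h1.exists_hasEigenvector
    have hinj := (LinearMap.injective_iff_surjective (f := B - β • 1)).2
      (LinearMap.range_eq_top.1 (h β hne))
    refine hv.2 (hinj ?_)
    simp [hv.apply_eq_smul]
  have h1 := (IsAlgClosed.splits B.charpoly).eq_prod_roots
  rw [Multiset.eq_replicate_card.2 h0, LinearMap.charpoly_monic B] at h1
  simp only [map_one, Multiset.map_replicate, map_zero, sub_zero, Multiset.prod_replicate,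
    one_mul] at h1
  have h2 := LinearMap.aeval_self_charpoly B
  rw [h1, map_pow, Polynomial.aeval_X] at h2
  exact ⟨_, h2⟩

/-- The operator `(t, y, z) ↦ (t + 1, α y, N z)`. -/
def shiftDiagonal {p m : ℕ} (α : Fin p → F) (N : Matrix (Fin m) (Fin m) F)
    (x : F × (Fin p → F) × (Fin m → F)) : F × (Fin p → F) × (Fin m → F) :=
  (x.1 + 1, α * x.2.1, N *ᵥ x.2.2)

/-- Induction on dimension. A left eigenvector of `B` with eigenvalue `β ≠ 0` gives a coordinate `s
↦ β s`, coupled to the complement by a term `s • c`. The shear by `s • Q(t)` removes it, even when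
`β` is also an eigenvalue on the complement, thanks to the shift in `t`. With no nonzero eigenvalue
left, `B` is nilpotent. -/
theorem exists_polyConj_shiftDiagonal [IsAlgClosed F] [CharZero F] (d : ℕ) {V : Type*}
    [AddCommGroup V] [Module F V] [FiniteDimensional F V] (hd : Module.finrank F V = d)
    (B : Module.End F V) :
    ∃ (p m : ℕ) (α : Fin p → F) (N : Matrix (Fin m) (Fin m) F), p + m = d ∧ (∀ i, α i ≠ 0) ∧
      IsNilpotent N ∧
      PolyConj F (fun x : F × V => (x.1 + 1, B x.2)) (shiftDiagonal α N) := by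
  induction d using Nat.strong_induction_on generalizing V with
  | _ d ih =>
  by_cases h : ∃ β : F, β ≠ 0 ∧ LinearMap.range (B - β • 1) ≠ ⊤
  · obtain ⟨β, hβ, h⟩ := h
    obtain ⟨u, hu⟩ : ∃ u, u ∉ LinearMap.range (B - β • 1) := by
      by_contra! H
      exact h (eq_top_iff.2 fun x _ => H x)
    obtain ⟨l₀, hl₀, hker⟩ := Submodule.exists_le_ker_of_notMem hu
    -- A form vanishing on the range of `B - β` is a left eigenvector; rescaling `u` normalizes it.
    obtain ⟨l, v, hv, hl⟩ : ∃ (l : Module.Dual F V) (v : V), l v = 1 ∧ ∀ x, l (B x) = β * l x := by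
      refine ⟨l₀, (l₀ u)⁻¹ • u, by simp [hl₀], fun x => ?_⟩
      have := hker ⟨x, rfl⟩
      simpa [sub_eq_zero] using this
    let B' : Module.End F (LinearMap.ker l) := B.restrict fun x hx => by
      rw [LinearMap.mem_ker] at hx ⊢
      rw [hl, hx, mul_zero]
    have hfin := finrank_ker_add_one l hv
    obtain ⟨p, m, α, N, hpm, hα, hN, hc⟩ := ih (Module.finrank F (LinearMap.ker l)) (by omega)
      rfl B'
    have hcm : B v - β • v ∈ LinearMap.ker l := by simp [hl, hv]
    let c : LinearMap.ker l := ⟨B v - β • v, hcm⟩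
    -- The coupling is linear in `s` and independent of `t`, so the right-hand side is constant.
    obtain ⟨Q, hQ, hQe⟩ := exists_difference_eq hβ B' (r := fun _ : F => c) (IsPoly.const c)
    have hc1 : PolyConj F (fun x : F × V => (x.1 + 1, B x.2))
        (fun x : (F × F) × LinearMap.ker l => ((x.1.1 + 1, β * x.1.2), B' x.2 + x.1.2 • c)) := by
      refine PolyConj.of_linearEquiv (((LinearEquiv.refl F F).prodCongr (splitEquiv l hv)).trans
        (LinearEquiv.prodAssoc F F F _).symm) fun x => ?_
      refine Prod.ext (Prod.ext rfl (hl x.2)) (Subtype.ext ?_)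
      show B x.2 - l (B x.2) • v = B (x.2 - l x.2 • v) + l x.2 • (B v - β • v)
      rw [hl, map_sub, map_smul, smul_sub, mul_comm, mul_smul]
      abel
    have hc2 : PolyConj F
        (fun x : (F × F) × LinearMap.ker l => ((x.1.1 + 1, β * x.1.2), B' x.2 + x.1.2 • c))
        (fun x : (F × F) × LinearMap.ker l => ((x.1.1 + 1, β * x.1.2), B' x.2)) := by
      refine PolyConj.of_shear (φ := fun y : F × F => y.2 • Q y.1)
        (IsPoly.smul isPoly_snd (hQ.comp isPoly_fst)) fun x y => Prod.ext rfl ?_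
      show B' (y + x.2 • Q x.1) + x.2 • c = B' y + (β * x.2) • Q (x.1 + 1)
      rw [← hQe x.1, map_add, map_smul, smul_sub, mul_comm, mul_smul]
      abel
    have hc3 : PolyConj F
        (fun x : (F × F) × LinearMap.ker l => ((x.1.1 + 1, β * x.1.2), B' x.2))
        (Prod.map (fun s : F => β * s) fun x : F × LinearMap.ker l => (x.1 + 1, B' x.2)) :=
      PolyConj.of_linearEquiv (((LinearEquiv.prodComm F F F).prodCongr
        (LinearEquiv.refl F (LinearMap.ker l))).trans (LinearEquiv.prodAssoc F F F _)) fun x => rfl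
    have hc4 := hc.prodMap (fun s : F => β * s)
    let e : (F × F × (Fin p → F) × (Fin m → F)) ≃ₗ[F] (F × (Fin (p + 1) → F) × (Fin m → F)) :=
      { toFun := fun x => (x.2.1, Fin.cons x.1 x.2.2.1, x.2.2.2)
        invFun := fun x => (x.2.1 0, x.1, Fin.tail x.2.1, x.2.2)
        map_add' := fun x y => Prod.ext rfl (Prod.ext (by
          funext i; refine Fin.cases ?_ (fun i => ?_) i <;> rfl) rfl)
        map_smul' := fun a x => Prod.ext rfl (Prod.ext (by
          funext i; refine Fin.cases ?_ (fun i => ?_) i <;> rfl) rfl)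
        left_inv := fun x => rfl
        right_inv := fun x => Prod.ext rfl (Prod.ext (Fin.cons_self_tail _) rfl) }
    refine ⟨p + 1, m, Fin.cons β α, N, by omega, Fin.cases hβ hα, hN,
      hc1.trans (hc2.trans (hc3.trans (hc4.trans (PolyConj.of_linearEquiv e fun x => ?_))))⟩
    refine Prod.ext rfl (Prod.ext ?_ rfl)
    funext i
    refine Fin.cases ?_ (fun i => ?_) i <;> rfl
  · push Not at h
    obtain ⟨k, hk⟩ := isNilpotent_of_forall_surjective B h
    subst hd
    let b := Module.finBasis F V
    refine ⟨0, _, Fin.elim0, LinearMap.toMatrix b b B, zero_add _, fun i => i.elim0,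
      ⟨k, ?_⟩, ?_⟩
    · rw [LinearMap.toMatrix_pow, hk, map_zero]
    · let z : V ≃ₗ[F] (Fin 0 → F) × (Fin (Module.finrank F V) → F) :=
        { b.equivFun with
          toFun := fun x => (0, b.equivFun x)
          invFun := fun y => b.equivFun.symm y.2
          map_add' := fun x y => Prod.ext (Subsingleton.elim _ _) (map_add b.equivFun x y)
          map_smul' := fun a x => Prod.ext (Subsingleton.elim _ _) (map_smul b.equivFun a x)
          left_inv := fun x => b.equivFun.symm_apply_apply x
          right_inv := fun y => Prod.ext (Subsingleton.elim _ _)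
            (b.equivFun.apply_symm_apply y.2) }
      refine PolyConj.of_linearEquiv ((LinearEquiv.refl F F).prodCongr z) fun x => ?_
      refine Prod.ext rfl (Prod.ext (Subsingleton.elim _ _) ?_)
      exact (LinearMap.toMatrix_mulVec_repr b b B x.2).symm

theorem polyConj_almostDiagonalOperator {n p m : ℕ} (h : (p + 1) + m = n) (α : Fin p → F)
    (N : Matrix (Fin m) (Fin m) F) :
    PolyConj F (shiftDiagonal α N) (almostDiagonalOperator h α N) := by
  subst h
  let e : (Fin (p + 1 + m) → F) ≃ₗ[F] (F × (Fin p → F) × (Fin m → F)) :=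
    { toFun := fun x => (x (Fin.castAdd m 0), fun i => x (Fin.castAdd m i.succ),
        fun i => x (Fin.natAdd (p + 1) i))
      invFun := fun y => Fin.append (Fin.cons y.1 y.2.1 : Fin (p + 1) → F) y.2.2
      map_add' := fun x y => rfl
      map_smul' := fun a x => rfl
      left_inv := fun x => by
        funext i
        refine Fin.addCases (fun i => ?_) (fun i => ?_) i
        · refine (Fin.append_left _ _ i).trans ?_
          refine Fin.cases ?_ (fun i => ?_) i <;> rfl
        · exact Fin.append_right _ _ i
      right_inv := fun y => by simp }
  refine (PolyConj.of_linearEquiv e fun x => ?_).symm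
  simp [e, almostDiagonalOperator, shiftDiagonal]
  funext i
  rfl

/-- Having no fixed point means that `b` is not in the range of `A - 1`; a form separating it from
this range supplies the shifted coordinate `t`. -/
theorem exists_conj_almostDiagonalOperator [IsAlgClosed F] [CharZero F] {n : ℕ}
    (A : Matrix (Fin n) (Fin n) F) (b : Fin n → F) (hf : ¬ HasFixedPoint (affineOperator A b)) :
    ∃ (p m : ℕ) (h : (p + 1) + m = n) (α : Fin p → F) (N : Matrix (Fin m) (Fin m) F),
      (∀ i, α i ≠ 0) ∧ IsNilpotent N ∧
      BiregularlyConjugate (affineOperator A b) (almostDiagonalOperator h α N) := by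
  have hb : b ∉ LinearMap.range (A.mulVecLin - 1) := by
    rintro ⟨x, hx⟩
    refine hf ⟨-x, ?_⟩
    rw [← hx]
    simp [affineOperator, Matrix.mulVec_neg]
    abel
  obtain ⟨l₀, hl₀, hker⟩ := Submodule.exists_le_ker_of_notMem hb
  obtain ⟨l, hv, hl⟩ : ∃ l : Module.Dual F (Fin n → F), l b = 1 ∧ ∀ x, l (A *ᵥ x) = l x := by
    refine ⟨(l₀ b)⁻¹ • l₀, by simp [hl₀], fun x => ?_⟩
    have : l₀ (A *ᵥ x - x) = 0 := hker ⟨x, rfl⟩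
    rw [map_sub, sub_eq_zero] at this
    simp [this]
  let B' : Module.End F (LinearMap.ker l) := A.mulVecLin.restrict fun x hx => by
    rw [LinearMap.mem_ker] at hx ⊢
    rw [Matrix.mulVecLin_apply, hl, hx]
  have hfin := finrank_ker_add_one l hv
  rw [Module.finrank_fin_fun] at hfin
  obtain ⟨p, m, α, N, hpm, hα, hN, hc⟩ := exists_polyConj_shiftDiagonal _ rfl B'
  have hcm : A *ᵥ b - b ∈ LinearMap.ker l := by simp [hl]
  let c : LinearMap.ker l := ⟨A *ᵥ b - b, hcm⟩
  -- Writing `x = t • b + y`, the coupling left over is `t • (A b - b)`, which the shear by `Q`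
  -- absorbs with `β = 1`.
  obtain ⟨Q, hQ, hQe⟩ := exists_difference_eq one_ne_zero B' (r := fun t : F => t • c)
    (IsPoly.id.smul (IsPoly.const c))
  have hc1 : PolyConj F (affineOperator A b)
      (fun x : F × LinearMap.ker l => (x.1 + 1, B' x.2 + x.1 • c)) := by
    refine PolyConj.of_linearEquiv (splitEquiv l hv) fun x => ?_
    have h1 : l (A *ᵥ x + b) = l x + 1 := by rw [map_add, hl, hv]
    refine Prod.ext h1 (Subtype.ext ?_)
    show A *ᵥ x + b - l (A *ᵥ x + b) • b = A *ᵥ (x - l x • b) + l x • (A *ᵥ b - b)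
    rw [h1, Matrix.mulVec_sub, Matrix.mulVec_smul, add_smul, smul_sub, one_smul]
    abel
  have hc2 : PolyConj F (fun x : F × LinearMap.ker l => (x.1 + 1, B' x.2 + x.1 • c))
      (fun x : F × LinearMap.ker l => (x.1 + 1, B' x.2)) := by
    refine PolyConj.of_shear hQ fun x y => Prod.ext rfl ?_
    show B' (y + Q x) + x • c = B' y + Q (x + 1)
    rw [← hQe x, map_add, one_smul]
    abel
  have h : (p + 1) + m = n := by omega
  exact ⟨p, m, h, α, N, hα, hN, biregularlyConjugate_iff.2
    (hc1.trans (hc2.trans (hc.trans (polyConj_almostDiagonalOperator h α N))))⟩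

end NormalForm

/-! ### Equivalence of endomorphisms and kernel dimensions of Jordan matrices -/

section Jordan

variable {F : Type*} [Field F]
variable {U V W X : Type*} [AddCommGroup U] [Module F U] [AddCommGroup V] [Module F V]
  [AddCommGroup W] [Module F W] [AddCommGroup X] [Module F X]

/-- Endomorphisms of two vector spaces are equivalent if a linear isomorphism carries one to the
other. -/
def EndEquiv (f : Module.End F V) (g : Module.End F W) : Prop :=
  ∃ e : V ≃ₗ[F] W, ∀ x, e (f x) = g (e x)

theorem EndEquiv.refl (f : Module.End F V) : EndEquiv f f := ⟨LinearEquiv.refl F V, fun _ => rfl⟩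

theorem EndEquiv.symm {f : Module.End F V} {g : Module.End F W} :
    EndEquiv f g → EndEquiv g f :=
  fun ⟨e, h⟩ => ⟨e.symm, fun x => by rw [LinearEquiv.symm_apply_eq, h, e.apply_symm_apply]⟩

theorem EndEquiv.trans {f : Module.End F U} {g : Module.End F V} {k : Module.End F W} :
    EndEquiv f g → EndEquiv g k → EndEquiv f k :=
  fun ⟨e, h⟩ ⟨e', h'⟩ => ⟨e.trans e', fun x => by simp [h, h']⟩

theorem EndEquiv.prodMap {f : Module.End F U} {g : Module.End F V} {f' : Module.End F W}
    {g' : Module.End F X} : EndEquiv f g → EndEquiv f' g' →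
      EndEquiv (f.prodMap f') (g.prodMap g') :=
  fun ⟨e, h⟩ ⟨e', h'⟩ => ⟨e.prodCongr e', fun x => Prod.ext (h x.1) (h' x.2)⟩

theorem EndEquiv.pow_apply {f : Module.End F V} {g : Module.End F W} {e : V ≃ₗ[F] W}
    (h : ∀ x, e (f x) = g (e x)) (j : ℕ) (x : V) : e ((f ^ j) x) = (g ^ j) (e x) := by
  induction j generalizing x with
  | zero => rfl
  | succ j ih => rw [pow_succ, pow_succ, Module.End.mul_apply, Module.End.mul_apply, ih, h]

theorem EndEquiv.isNilpotent {f : Module.End F V} {g : Module.End F W} (h : EndEquiv f g)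
    (hf : IsNilpotent f) : IsNilpotent g := by
  obtain ⟨e, h⟩ := h
  obtain ⟨k, hk⟩ := hf
  refine ⟨k, LinearMap.ext fun x => ?_⟩
  rw [← e.apply_symm_apply x, ← EndEquiv.pow_apply h, hk]
  simp

/-- The dimension of the kernel of `(f - μ) ^ j`. -/
noncomputable def kerDim (f : Module.End F V) (μ : F) (j : ℕ) : ℕ :=
  Module.finrank F (LinearMap.ker ((f - μ • 1) ^ j))

theorem EndEquiv.kerDim_eq {f : Module.End F V} {g : Module.End F W} (h : EndEquiv f g) (μ : F)
    (j : ℕ) : kerDim f μ j = kerDim g μ j := by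
  obtain ⟨e, h⟩ := h
  have h' : ∀ x, e ((f - μ • 1) x) = (g - μ • 1) (e x) := fun x => by simp [h]
  refine (e.submoduleMap (LinearMap.ker ((f - μ • 1) ^ j))).finrank_eq.trans ?_
  suffices H : Submodule.map (e : V →ₗ[F] W) (LinearMap.ker ((f - μ • 1) ^ j)) =
      LinearMap.ker ((g - μ • 1) ^ j) by
    rw [kerDim, ← H]
  ext y
  rw [LinearMap.mem_ker, Submodule.mem_map_equiv, LinearMap.mem_ker,
    ← e.map_eq_zero_iff, EndEquiv.pow_apply h', e.apply_symm_apply]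

theorem kerDim_prodMap [FiniteDimensional F V] [FiniteDimensional F W] (f : Module.End F V)
    (g : Module.End F W) (μ : F) (j : ℕ) :
    kerDim (f.prodMap g) μ j = kerDim f μ j + kerDim g μ j := by
  have h : ∀ x : V × W, ((f.prodMap g - μ • 1) ^ j) x =
      (((f - μ • 1) ^ j) x.1, ((g - μ • 1) ^ j) x.2) := by
    induction j with
    | zero => exact fun x => rfl
    | succ j ih =>
      intro x
      rw [pow_succ, pow_succ, pow_succ, Module.End.mul_apply, ih]
      rfl
  have e : LinearMap.ker ((f.prodMap g - μ • 1) ^ j) ≃ₗ[F]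
      LinearMap.ker ((f - μ • 1) ^ j) × LinearMap.ker ((g - μ • 1) ^ j) :=
    { toFun := fun x => (⟨x.1.1, congrArg Prod.fst ((h x.1).symm.trans x.2)⟩,
        ⟨x.1.2, congrArg Prod.snd ((h x.1).symm.trans x.2)⟩)
      invFun := fun y => ⟨(y.1.1, y.2.1), (h _).trans (Prod.ext y.1.2 y.2.2)⟩
      map_add' := fun _ _ => rfl
      map_smul' := fun _ _ => rfl
      left_inv := fun _ => rfl
      right_inv := fun _ => rfl }
  rw [kerDim, e.finrank_eq, Module.finrank_prod]
  rfl

theorem kerDim_eq_zero_of_injective {f : Module.End F V} {μ : F}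
    (h : Function.Injective (f - μ • 1 : Module.End F V)) (j : ℕ) : kerDim f μ j = 0 := by
  have : LinearMap.ker ((f - μ • 1) ^ j) = ⊥ := by
    rw [LinearMap.ker_eq_bot, Module.End.coe_pow]
    exact h.iterate j
  rw [kerDim, this, finrank_bot]

theorem endEquiv_mulVecLin_iff {n : ℕ} {A B : Matrix (Fin n) (Fin n) F} :
    EndEquiv A.mulVecLin B.mulVecLin ↔ SimilarMatrix A B := by
  constructor
  · rintro ⟨e, h⟩
    let S := LinearMap.toMatrix' e.toLinearMap
    have hS : IsUnit S := by
      rw [LinearMap.isUnit_toMatrix'_iff]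
      exact (Module.End.isUnit_iff _).2 e.bijective
    have hd := (Matrix.isUnit_iff_isUnit_det S).1 hS
    have hSA : S * A = B * S := by
      apply Matrix.toLin'.injective
      refine LinearMap.ext fun x => ?_
      rw [Matrix.toLin'_mul, Matrix.toLin'_mul, Matrix.toLin'_toMatrix']
      exact h x
    refine ⟨S, hS, ?_⟩
    rw [Matrix.mul_assoc, ← hSA, ← Matrix.mul_assoc, Matrix.nonsing_inv_mul _ hd, Matrix.one_mul]
  · rintro ⟨S, hS, h⟩
    have hd := (Matrix.isUnit_iff_isUnit_det S).1 hS
    refine ⟨LinearEquiv.ofBijective S.mulVecLin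
      ⟨Matrix.mulVec_injective_of_isUnit hS, Matrix.mulVec_surjective_iff_isUnit.2 hS⟩, fun x => ?_⟩
    show S *ᵥ (A *ᵥ x) = B *ᵥ (S *ᵥ x)
    rw [Matrix.mulVec_mulVec, Matrix.mulVec_mulVec, h, Matrix.mul_assoc S⁻¹, ← Matrix.mul_assoc S,
      Matrix.mul_nonsing_inv _ hd, Matrix.one_mul]

theorem castMatrix_rfl {n : ℕ} (A : Matrix (Fin n) (Fin n) F) : castMatrix rfl A = A := rfl

theorem endEquiv_castMatrix {m n : ℕ} (h : m = n) (A : Matrix (Fin m) (Fin m) F) :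
    EndEquiv (castMatrix h A).mulVecLin A.mulVecLin := by
  subst h
  exact EndEquiv.refl _

theorem endEquiv_directSum {p q : ℕ} (A : Matrix (Fin p) (Fin p) F) (B : Matrix (Fin q) (Fin q) F) :
    EndEquiv (directSum A B).mulVecLin (A.mulVecLin.prodMap B.mulVecLin) := by
  refine ⟨(LinearEquiv.funCongrLeft F F finSumFinEquiv).trans
    (LinearEquiv.sumArrowLequivProdArrow (Fin p) (Fin q) F F), fun x => ?_⟩
  have h : (directSum A B *ᵥ x) ∘ finSumFinEquiv =
      Matrix.fromBlocks A 0 0 B *ᵥ (x ∘ finSumFinEquiv) := by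
    rw [directSum, Matrix.reindex_apply, Matrix.submatrix_mulVec_equiv, Equiv.symm_symm]
    funext i
    simp
  rw [Matrix.fromBlocks_mulVec] at h
  refine Prod.ext (funext fun i => ?_) (funext fun i => ?_)
  · refine (congrFun h (Sum.inl i)).trans ?_
    simp
    rfl
  · refine (congrFun h (Sum.inr i)).trans ?_
    simp
    rfl

theorem jordanBlock_mulVec (d : ℕ) (μ : F) (x : Fin d → F) (i : Fin d) :
    (jordanBlock d μ *ᵥ x) i = μ * x i + if h : (i : ℕ) + 1 < d then x ⟨i + 1, h⟩ else 0 := by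
  have h1 : ∀ j, jordanBlock d μ i j * x j =
      (if i = j then μ * x j else 0) + if (i : ℕ) + 1 = j then x j else 0 := by
    intro j
    rw [jordanBlock, Matrix.of_apply]
    by_cases hij : i = j
    · subst hij
      simp
    · simp [hij]
  rw [Matrix.mulVec, dotProduct, Finset.sum_congr rfl fun j _ => h1 j, Finset.sum_add_distrib,
    Finset.sum_ite_eq Finset.univ i, if_pos (Finset.mem_univ _)]
  congr 1
  split_ifs with h
  · rw [Finset.sum_eq_single ⟨i + 1, h⟩]
    · simp
    · intro j _ hj
      rw [if_neg]
      rintro h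
      exact hj (Fin.ext h.symm)
    · simp
  · refine Finset.sum_eq_zero fun j _ => if_neg ?_
    rintro h'
    exact h (h' ▸ j.2)

theorem isUpperTriangular_jordanBlock (d : ℕ) (μ : F) :
    (jordanBlock d μ).IsUpperTriangular := by
  intro i j h
  have h' : (j : ℕ) < i := h
  rw [jordanBlock, Matrix.of_apply, if_neg (by rintro rfl; exact lt_irrefl _ h'),
    if_neg (by omega)]

theorem jordanBlock_sub (d : ℕ) (ν μ : F) :
    (jordanBlock d ν).mulVecLin - μ • 1 = (jordanBlock d (ν - μ)).mulVecLin := by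
  refine LinearMap.ext fun x => funext fun i => ?_
  show (jordanBlock d ν *ᵥ x) i - μ * x i = (jordanBlock d (ν - μ) *ᵥ x) i
  rw [jordanBlock_mulVec, jordanBlock_mulVec]
  ring

theorem jordanBlock_zero_pow_apply (d j : ℕ) (x : Fin d → F) (i : Fin d) :
    ((jordanBlock d (0 : F)).mulVecLin ^ j) x i =
      if h : (i : ℕ) + j < d then x ⟨i + j, h⟩ else 0 := by
  induction j generalizing x with
  | zero => simp
  | succ j ih =>
    rw [pow_succ, Module.End.mul_apply, ih, Matrix.mulVecLin_apply]
    by_cases h : (i : ℕ) + (j + 1) < d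
    · rw [dif_pos h, dif_pos (by omega), jordanBlock_mulVec, zero_mul, zero_add, dif_pos (by
        show (i : ℕ) + j + 1 < d; omega)]
      rfl
    · rw [dif_neg h]
      split_ifs with h'
      · rw [jordanBlock_mulVec, zero_mul, zero_add, dif_neg (by show ¬ (i : ℕ) + j + 1 < d; omega)]
      · rfl

theorem kerDim_jordanBlock [DecidableEq F] (d : ℕ) (ν μ : F) (j : ℕ) :
    kerDim (jordanBlock d ν).mulVecLin μ j = if ν = μ then min d j else 0 := by
  split_ifs with h
  · subst h
    rw [kerDim, jordanBlock_sub, sub_self]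
    -- The `j`-th power of the nilpotent block has the same kernel as forgetting the first `j`
    -- coordinates; truncated subtraction accounts for `min d j`.
    let R : (Fin d → F) →ₗ[F] (Fin (d - j) → F) :=
      LinearMap.funLeft F F fun i => ⟨i + j, by omega⟩
    have hR : Function.Surjective R := LinearMap.funLeft_surjective_of_injective _ _ _
      fun i k h => Fin.ext (by simpa using h)
    have hker : LinearMap.ker ((jordanBlock d (0 : F)).mulVecLin ^ j) = LinearMap.ker R := by
      ext x
      rw [LinearMap.mem_ker, LinearMap.mem_ker]
      constructor
      · intro hx
        funext i
        have := congrFun hx ⟨i, by omega⟩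
        rw [jordanBlock_zero_pow_apply, dif_pos (by show (i : ℕ) + j < d; omega)] at this
        exact this
      · intro hx
        funext i
        rw [jordanBlock_zero_pow_apply]
        split_ifs with h
        · exact congrFun hx ⟨i, by omega⟩
        · rfl
    have := LinearMap.finrank_range_add_finrank_ker R
    rw [LinearMap.range_eq_top.2 hR, finrank_top, Module.finrank_fin_fun, Module.finrank_fin_fun]
      at this
    rw [hker]
    omega
  · refine kerDim_eq_zero_of_injective ?_ j
    rw [jordanBlock_sub]
    refine Matrix.mulVec_injective_of_isUnit ((Matrix.isUnit_iff_isUnit_det _).2 ?_)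
    rw [Matrix.det_of_isUpperTriangular (isUpperTriangular_jordanBlock _ _), isUnit_iff_ne_zero,
      Finset.prod_ne_zero_iff]
    intro i _
    simpa [jordanBlock, sub_eq_zero] using h

theorem kerDim_jordanMatrix [DecidableEq F] (L : List (ℕ × F)) (μ : F) (j : ℕ) :
    kerDim (jordanMatrix L).mulVecLin μ j =
      (L.map fun b => if b.2 = μ then min b.1 j else 0).sum := by
  induction L with
  | nil =>
    refine kerDim_eq_zero_of_injective (fun x y _ => ?_) j
    exact Subsingleton.elim (α := Fin 0 → F) x y
  | cons b L ih =>
    rw [List.map_cons, List.sum_cons, ← ih, ← kerDim_jordanBlock, ← kerDim_prodMap]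
    exact (endEquiv_directSum _ _).kerDim_eq μ j

end Jordan

/-! ### Existence and uniqueness of the Jordan form -/

section JordanExistence

variable {F : Type*} [Field F]

/-- Bijectivity of `ψ ∘ φ` makes the image of `φ` and the kernel of `ψ` complementary. -/
theorem endEquiv_prodMap_ker {V W : Type*} [AddCommGroup V] [Module F V] [AddCommGroup W]
    [Module F W] {f : Module.End F V} {N : Module.End F W} {φ : W →ₗ[F] V} {ψ : V →ₗ[F] W}
    (hφψ : Function.Bijective (ψ ∘ₗ φ)) (hφ : ∀ c, f (φ c) = φ (N c))
    (hψ : ∀ x ∈ LinearMap.ker ψ, f x ∈ LinearMap.ker ψ) :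
    EndEquiv f (N.prodMap (f.restrict hψ)) := by
  refine EndEquiv.symm ⟨LinearEquiv.ofBijective (φ.coprod (LinearMap.ker ψ).subtype) ⟨?_, ?_⟩,
    fun x => ?_⟩
  · rw [← LinearMap.ker_eq_bot, LinearMap.ker_eq_bot']
    rintro ⟨c, w, hw⟩ h
    have h1 : φ c + w = 0 := h
    have hc : c = 0 := by
      apply hφψ.1
      have := congrArg ψ h1
      rw [map_add, LinearMap.mem_ker.1 hw, add_zero, map_zero] at this
      rw [map_zero]
      exact this
    subst hc
    rw [map_zero, zero_add] at h1
    subst h1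
    rfl
  · intro x
    obtain ⟨c, hc⟩ := hφψ.2 (ψ x)
    refine ⟨(c, ⟨x - φ c, ?_⟩), ?_⟩
    · rw [LinearMap.mem_ker, map_sub, sub_eq_zero]
      exact hc.symm
    · simp
  · show φ (N x.1) + f x.2 = f (φ x.1 + x.2)
    rw [map_add, hφ]

/-- For `g = f - μ`, a longest chain `v, g v, …, g ^ r v` spans a block. Its invariant complement is
cut out by the forms `l ∘ g ^ i`, `i ≤ r`, where `l` kills the range of `g ^ (r + 1)` but not `g ^ r
v`. -/
theorem exists_jordanBlock_summand [IsAlgClosed F] {V : Type*} [AddCommGroup V] [Module F V]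
    [FiniteDimensional F V] [Nontrivial V] (f : Module.End F V) :
    ∃ (r : ℕ) (μ : F) (p : Submodule F V) (hp : ∀ x ∈ p, f x ∈ p),
      EndEquiv f ((jordanBlock (r + 1) μ).mulVecLin.prodMap (f.restrict hp)) := by
  classical
  obtain ⟨μ, hμ⟩ := Module.End.exists_eigenvalue f
  obtain ⟨u₀, hu₀⟩ := hμ.exists_hasEigenvector
  let g : Module.End F V := f - μ • 1
  have hgf : ∀ x, f x = g x + μ • x := fun x => by simp [g]
  have hex : ∃ k : ℕ, LinearMap.ker (g ^ k) = LinearMap.ker (g ^ k.succ) := by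
    obtain ⟨k, _, hk⟩ := Module.End.exists_ker_pow_eq_ker_pow_succ g
    exact ⟨k, hk⟩
  obtain ⟨r, hr⟩ : ∃ r, Nat.find hex = r + 1 := by
    refine Nat.exists_eq_succ_of_ne_zero fun h0 => hu₀.2 ?_
    have h := Nat.find_spec hex
    rw [h0] at h
    have h1 : u₀ ∈ LinearMap.ker (g ^ Nat.succ 0) := by
      simp [g, hu₀.apply_eq_smul]
    rw [← h] at h1
    exact h1
  have hspec := Nat.find_spec hex
  have hmin := Nat.find_min hex (m := r) (by omega)
  rw [hr] at hspec
  obtain ⟨v, hv1, hv0⟩ : ∃ v, (g ^ (r + 1)) v = 0 ∧ (g ^ r) v ≠ 0 := by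
    by_contra! H
    refine hmin (le_antisymm (fun x hx => ?_) fun x hx => H x hx)
    rw [LinearMap.mem_ker] at hx ⊢
    rw [Nat.succ_eq_add_one, pow_succ', Module.End.mul_apply, hx, map_zero]
  -- The kernels of the powers of `g` have stabilized at exponent `r + 1`; a preimage would force `g
  -- ^ r v = 0`.
  have hnot : (g ^ r) v ∉ LinearMap.range (g ^ (r + 1)) := by
    rintro ⟨y, hy⟩
    have hy' : y ∈ LinearMap.ker (g ^ (r + 1 + 1)) := by
      rw [LinearMap.mem_ker, pow_succ' g (r + 1), Module.End.mul_apply, hy,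
        ← Module.End.mul_apply, ← pow_succ', hv1]
    have h2 : LinearMap.ker (g ^ (r + 1)) = LinearMap.ker (g ^ (r + 1 + 1)) := hspec
    rw [← h2, LinearMap.mem_ker] at hy'
    exact hv0 (hy.symm.trans hy')
  obtain ⟨l, hl, hker⟩ := Submodule.exists_le_ker_of_notMem hnot
  have hl0 : ∀ x, l ((g ^ (r + 1)) x) = 0 := fun x => hker ⟨x, rfl⟩
  let φ : (Fin (r + 1) → F) →ₗ[F] V := Fintype.linearCombination F fun j => (g ^ (r - j : ℕ)) v
  have hφ : ∀ c, φ c = ∑ j, c j • (g ^ (r - j : ℕ)) v := fun c => rfl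
  let ψ : V →ₗ[F] (Fin (r + 1) → F) := LinearMap.pi fun i => l ∘ₗ (g ^ (i : ℕ))
  have hψ : ∀ x i, ψ x i = l ((g ^ (i : ℕ)) x) := fun x i => rfl
  let T : Matrix (Fin (r + 1)) (Fin (r + 1)) F :=
    Matrix.of fun i j => l ((g ^ (i + (r - j) : ℕ)) v)
  have hT : ∀ c, ψ (φ c) = T *ᵥ c := by
    intro c
    funext i
    rw [hψ, hφ, map_sum, map_sum]
    refine Finset.sum_congr rfl fun j _ => ?_
    rw [map_smul, map_smul, ← Module.End.mul_apply, ← pow_add, smul_eq_mul, mul_comm]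
    rfl
  -- Below the diagonal the exponent exceeds `r`, where `l` vanishes; on it the entry is `l (g ^ r
  -- v)`.
  have hTu : IsUnit T := by
    rw [Matrix.isUnit_iff_isUnit_det, Matrix.det_of_isUpperTriangular (M := T),
      isUnit_iff_ne_zero, Finset.prod_ne_zero_iff]
    · intro i _
      have : (i + (r - i) : ℕ) = r := by omega
      simpa [T, this] using hl
    · intro i j h
      have h' : (j : ℕ) < i := h
      have : (i + (r - j) : ℕ) = (r + 1) + (i - j - 1) := by omega
      show l ((g ^ (i + (r - j) : ℕ)) v) = 0
      rw [this, pow_add, Module.End.mul_apply, hl0]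
  have hbij : Function.Bijective (ψ ∘ₗ φ) := by
    have : (ψ ∘ₗ φ : (Fin (r + 1) → F) →ₗ[F] _) = T.mulVecLin := LinearMap.ext hT
    rw [this]
    exact ⟨Matrix.mulVec_injective_of_isUnit hTu, Matrix.mulVec_surjective_iff_isUnit.2 hTu⟩
  refine ⟨r, μ, LinearMap.ker ψ, fun x hx => ?_, endEquiv_prodMap_ker hbij (fun c => ?_) _⟩
  · rw [LinearMap.mem_ker] at hx ⊢
    funext i
    have hxi : ∀ (k : ℕ), k < r + 1 → l ((g ^ k) x) = 0 := fun k hk => congrFun hx ⟨k, hk⟩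
    rw [hψ, hgf, map_add, map_smul, map_add, map_smul, hxi i i.2, smul_zero, add_zero,
      ← Module.End.mul_apply, ← pow_succ]
    rcases Nat.lt_or_ge ((i : ℕ) + 1) (r + 1) with h | h
    · exact hxi _ h
    · have : (i : ℕ) + 1 = r + 1 := by omega
      rw [this, hl0]
      rfl
  · have h1 : g (φ c) = ∑ i : Fin r, c i.succ • (g ^ (r - i : ℕ)) v := by
      rw [hφ, map_sum, Fin.sum_univ_succ, map_smul, ← Module.End.mul_apply, ← pow_succ']
      simp only [Fin.val_zero, Nat.sub_zero, hv1, smul_zero, zero_add]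
      refine Finset.sum_congr rfl fun i _ => ?_
      have : r - (i : ℕ) = r - (i.succ : ℕ) + 1 := by
        have := i.2
        rw [Fin.val_succ]
        omega
      rw [map_smul, ← Module.End.mul_apply, ← pow_succ', this]
    have h2 : φ (jordanBlock (r + 1) μ *ᵥ c) =
        μ • φ c + ∑ i : Fin r, c i.succ • (g ^ (r - i : ℕ)) v := by
      rw [hφ, hφ, Finset.smul_sum]
      simp only [jordanBlock_mulVec, add_smul, Finset.sum_add_distrib, mul_smul]
      congr 1
      rw [Fin.sum_univ_castSucc]
      simp
      rfl
    rw [hgf, h1, Matrix.mulVecLin_apply, h2, add_comm]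

theorem exists_endEquiv_jordanMatrix [IsAlgClosed F] (d : ℕ) {V : Type*} [AddCommGroup V]
    [Module F V] [FiniteDimensional F V] (hd : Module.finrank F V = d) (f : Module.End F V) :
    ∃ L : List (ℕ × F), (∀ b ∈ L, 0 < b.1) ∧ EndEquiv f (jordanMatrix L).mulVecLin := by
  induction d using Nat.strong_induction_on generalizing V with
  | _ d ih =>
  rcases subsingleton_or_nontrivial V with hV | hV
  · have h0 : Module.finrank F V = Module.finrank F (Fin 0 → F) := by
      rw [Module.finrank_zero_of_subsingleton, Module.finrank_fin_fun]
    have e : V ≃ₗ[F] (Fin 0 → F) := LinearEquiv.ofFinrankEq V (Fin 0 → F) h0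
    exact ⟨[], by simp, e, fun x => Subsingleton.elim (α := Fin 0 → F) _ _⟩
  · obtain ⟨r, μ, p, hp, h⟩ := exists_jordanBlock_summand f
    have hfin : Module.finrank F V = r + 1 + Module.finrank F p := by
      obtain ⟨e, -⟩ := h
      rw [e.finrank_eq, Module.finrank_prod, Module.finrank_fin_fun]
    obtain ⟨L, hL, hLe⟩ := ih (Module.finrank F p) (by omega) rfl (f.restrict hp)
    refine ⟨(r + 1, μ) :: L, ?_, h.trans (((EndEquiv.refl _).prodMap hLe).trans
      (endEquiv_directSum _ _).symm)⟩
    rintro b hb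
    rcases List.mem_cons.1 hb with rfl | hb
    · exact Nat.succ_pos r
    · exact hL b hb

theorem endEquiv_jordanMatrix_append (L L' : List (ℕ × F)) :
    EndEquiv (jordanMatrix (L ++ L')).mulVecLin
      ((jordanMatrix L).mulVecLin.prodMap (jordanMatrix L').mulVecLin) := by
  induction L with
  | nil =>
    refine ⟨{ toFun := fun x => ((0 : Fin 0 → F), x)
              invFun := fun y => y.2
              map_add' := fun x y => Prod.ext (Subsingleton.elim (α := Fin 0 → F) _ _) rfl
              map_smul' := fun a x => Prod.ext (Subsingleton.elim (α := Fin 0 → F) _ _) rfl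
              left_inv := fun x => rfl
              right_inv := fun y => Prod.ext (Subsingleton.elim (α := Fin 0 → F) _ _) rfl },
      fun x => Prod.ext (Subsingleton.elim (α := Fin 0 → F) _ _) rfl⟩
  | cons b L ih =>
    refine (endEquiv_directSum _ _).trans (((EndEquiv.refl _).prodMap ih).trans (EndEquiv.trans ?_
      ((endEquiv_directSum _ _).symm.prodMap (EndEquiv.refl _))))
    exact ⟨(LinearEquiv.prodAssoc F _ _ _).symm, fun x => rfl⟩

theorem endEquiv_jordanMatrix_of_perm {L L' : List (ℕ × F)} (h : L.Perm L') :
    EndEquiv (jordanMatrix L).mulVecLin (jordanMatrix L').mulVecLin := by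
  induction h with
  | nil => exact EndEquiv.refl _
  | cons b _ ih =>
    exact (endEquiv_directSum _ _).trans (((EndEquiv.refl _).prodMap ih).trans
      (endEquiv_directSum _ _).symm)
  | swap b c L =>
    have h : ∀ b c : ℕ × F, EndEquiv (jordanMatrix (b :: c :: L)).mulVecLin
        ((jordanBlock b.1 b.2).mulVecLin.prodMap
          ((jordanBlock c.1 c.2).mulVecLin.prodMap (jordanMatrix L).mulVecLin)) := fun b c =>
      (endEquiv_directSum _ _).trans ((EndEquiv.refl _).prodMap (endEquiv_directSum _ _))
    refine (h _ _).trans (EndEquiv.trans ?_ (h _ _).symm)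
    exact ⟨((LinearEquiv.prodAssoc F _ _ _).symm.trans
      ((LinearEquiv.prodComm F _ _).prodCongr (LinearEquiv.refl F _))).trans
        (LinearEquiv.prodAssoc F _ _ _), fun x => rfl⟩
  | trans _ _ h1 h2 => exact h1.trans h2

/-- The first difference in `j` counts the blocks longer than `j`, the second those of length
exactly `j + 1`. Blocks of size zero would be invisible, hence the positivity. -/
theorem perm_of_sum_min_eq {F : Type*} [DecidableEq F] {L L' : List (ℕ × F)} (hL : ∀ b ∈ L, 0 < b.1)
    (hL' : ∀ b ∈ L', 0 < b.1)
    (h : ∀ μ j, (L.map fun b => if b.2 = μ then min b.1 j else 0).sum =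
      (L'.map fun b => if b.2 = μ then min b.1 j else 0).sum) : L.Perm L' := by
  have h1 : ∀ (L : List (ℕ × F)) (μ : F) (j : ℕ),
      (L.map fun b => if b.2 = μ then min b.1 (j + 1) else 0).sum =
        (L.map fun b => if b.2 = μ then min b.1 j else 0).sum +
          L.countP fun b => decide (b.2 = μ) && decide (j < b.1) := by
    intro L μ j
    induction L with
    | nil => rfl
    | cons b L ih =>
      rw [List.map_cons, List.sum_cons, List.map_cons, List.sum_cons, List.countP_cons, ih]
      by_cases hb : b.2 = μ
      · by_cases hj : j < b.1
        · simp [hb, hj]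
          omega
        · simp [hb, hj]
          omega
      · simp [hb]
  have h2 : ∀ (L : List (ℕ × F)) (μ : F) (j : ℕ), (L.countP fun b => decide (b.2 = μ) && decide (j < b.1)) =
      (L.countP fun b => decide (b.2 = μ) && decide (j + 1 < b.1)) + L.count (j + 1, μ) := by
    intro L μ j
    induction L with
    | nil => rfl
    | cons b L ih =>
      obtain ⟨d, ν⟩ := b
      rw [List.countP_cons, List.countP_cons, List.count_cons, ih]
      by_cases hb : ν = μ
      · subst hb
        rcases lt_trichotomy d (j + 1) with hd | hd | hd
        · have h' : ¬ j + 1 < d := by omega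
          rcases Nat.lt_or_ge j d with h | h
          · omega
          · simp [hd.ne, h', Nat.not_lt.2 h]
        · subst hd
          simp
          omega
        · simp [hd.ne', hd, (Nat.lt_succ_self j).trans hd]
          omega
      · simp [hb]
  have h3 : ∀ μ j, (L.countP fun b => decide (b.2 = μ) && decide (j < b.1)) =
      L'.countP fun b => decide (b.2 = μ) && decide (j < b.1) := by
    intro μ j
    have := h μ (j + 1)
    rw [h1, h1, h μ j] at this
    omega
  rw [List.perm_iff_count]
  rintro ⟨d, μ⟩
  rcases d with _ | d
  · rw [List.count_eq_zero_of_not_mem fun h => absurd (hL _ h) (lt_irrefl _),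
      List.count_eq_zero_of_not_mem fun h => absurd (hL' _ h) (lt_irrefl _)]
  · have e1 := h2 L μ d
    have e2 := h2 L' μ d
    rw [h3, h3 μ (d + 1)] at e1
    omega

theorem endEquiv_jordanMatrix_iff {L L' : List (ℕ × F)} (hL : ∀ b ∈ L, 0 < b.1)
    (hL' : ∀ b ∈ L', 0 < b.1) :
    EndEquiv (jordanMatrix L).mulVecLin (jordanMatrix L').mulVecLin ↔ L.Perm L' := by
  classical
  refine ⟨fun h => perm_of_sum_min_eq hL hL' fun μ j => ?_, endEquiv_jordanMatrix_of_perm⟩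
  rw [← kerDim_jordanMatrix, ← kerDim_jordanMatrix, h.kerDim_eq]

theorem endEquiv_of_kerDim_eq [IsAlgClosed F] {V W : Type*} [AddCommGroup V] [Module F V]
    [FiniteDimensional F V] [AddCommGroup W] [Module F W] [FiniteDimensional F W]
    {f : Module.End F V} {g : Module.End F W} (h : ∀ μ j, kerDim f μ j = kerDim g μ j) :
    EndEquiv f g := by
  classical
  obtain ⟨L, hL, hf⟩ := exists_endEquiv_jordanMatrix _ rfl f
  obtain ⟨L', hL', hg⟩ := exists_endEquiv_jordanMatrix _ rfl g
  refine hf.trans (EndEquiv.trans (endEquiv_jordanMatrix_of_perm ?_) hg.symm)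
  refine perm_of_sum_min_eq hL hL' fun μ j => ?_
  rw [← kerDim_jordanMatrix, ← kerDim_jordanMatrix, ← hf.kerDim_eq, ← hg.kerDim_eq, h]

theorem IsJordanMatrix.endEquiv {n : ℕ} {J : Matrix (Fin n) (Fin n) F} {L : List (ℕ × F)}
    (h : IsJordanMatrix J L) : EndEquiv J.mulVecLin (jordanMatrix L).mulVecLin := by
  obtain ⟨-, h, rfl⟩ := h
  exact endEquiv_castMatrix h _

theorem exists_isJordanForm [IsAlgClosed F] {n : ℕ} (A : Matrix (Fin n) (Fin n) F) :
    ∃ (J : Matrix (Fin n) (Fin n) F) (L : List (ℕ × F)), IsJordanForm A J L := by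
  obtain ⟨L, hL, h⟩ := exists_endEquiv_jordanMatrix _ rfl A.mulVecLin
  have hn : jordanSize L = n := by
    obtain ⟨e, -⟩ := h
    simpa using e.finrank_eq.symm
  exact ⟨castMatrix hn (jordanMatrix L), L, ⟨hL, hn, rfl⟩,
    endEquiv_mulVecLin_iff.1 (h.trans (endEquiv_castMatrix hn _).symm)⟩

end JordanExistence

/-! ### Nonsingular and nilpotent parts -/

section Decompositions

variable {F : Type*} [Field F]

theorem charpoly_directSum {p q : ℕ} (A : Matrix (Fin p) (Fin p) F)
    (B : Matrix (Fin q) (Fin q) F) : (directSum A B).charpoly = A.charpoly * B.charpoly := by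
  rw [directSum, Matrix.charpoly_reindex, Matrix.charpoly_fromBlocks_zero₂₁]

theorem SimilarMatrix.charpoly_eq {n : ℕ} {A B : Matrix (Fin n) (Fin n) F}
    (h : SimilarMatrix A B) : A.charpoly = B.charpoly := by
  obtain ⟨S, hS, rfl⟩ := h
  obtain ⟨U, rfl⟩ := hS
  exact Matrix.charpoly_units_conj' U B

theorem roots_charpoly_of_isNilpotent {m : ℕ} {N : Matrix (Fin m) (Fin m) F}
    (hN : IsNilpotent N) : N.charpoly.roots = Multiset.replicate m 0 := by
  have h := (Matrix.isNilpotent_charpoly_sub_pow_of_isNilpotent hN).eq_zero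
  rw [sub_eq_zero, Fintype.card_fin] at h
  rw [h, Polynomial.roots_X_pow, Multiset.nsmul_singleton]

theorem zero_notMem_roots_charpoly {k : ℕ} {A : Matrix (Fin k) (Fin k) F} (hA : IsUnit A) :
    (0 : F) ∉ A.charpoly.roots := by
  intro h
  have h0 := Polynomial.isRoot_of_mem_roots h
  rw [Polynomial.IsRoot.def, Matrix.eval_charpoly] at h0
  simp only [map_zero, zero_sub, Matrix.det_neg] at h0
  have := (Matrix.isUnit_iff_isUnit_det A).1 hA
  simp [this.ne_zero] at h0

theorem IsStarCircDecomposition.endEquiv {n k m : ℕ} {h : k + m = n} {A : Matrix (Fin n) (Fin n) F}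
    {As : Matrix (Fin k) (Fin k) F} {Ao : Matrix (Fin m) (Fin m) F}
    (hA : IsStarCircDecomposition h A As Ao) :
    EndEquiv A.mulVecLin (As.mulVecLin.prodMap Ao.mulVecLin) :=
  ((endEquiv_mulVecLin_iff.2 hA.2.2).trans (endEquiv_castMatrix h _)).trans (endEquiv_directSum _ _)

theorem IsStarCircDecomposition.roots_charpoly {n k m : ℕ} {h : k + m = n}
    {A : Matrix (Fin n) (Fin n) F} {As : Matrix (Fin k) (Fin k) F} {Ao : Matrix (Fin m) (Fin m) F}
    (hA : IsStarCircDecomposition h A As Ao) :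
    A.charpoly.roots = As.charpoly.roots + Multiset.replicate m 0 := by
  subst h
  rw [hA.2.2.charpoly_eq, castMatrix_rfl, charpoly_directSum, Polynomial.roots_mul
    (mul_ne_zero (Matrix.charpoly_monic _).ne_zero (Matrix.charpoly_monic _).ne_zero),
    roots_charpoly_of_isNilpotent hA.2.1]

theorem IsStarCircDecomposition.filter_roots_charpoly [DecidableEq F] {n k m : ℕ} {h : k + m = n}
    {A : Matrix (Fin n) (Fin n) F} {As : Matrix (Fin k) (Fin k) F} {Ao : Matrix (Fin m) (Fin m) F}
    (hA : IsStarCircDecomposition h A As Ao) :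
    A.charpoly.roots.filter (· ≠ 0) = As.charpoly.roots := by
  have h1 : As.charpoly.roots.filter (· ≠ 0) = As.charpoly.roots :=
    Multiset.filter_eq_self.2 fun a ha h0 => zero_notMem_roots_charpoly hA.1 (h0 ▸ ha)
  have h2 : (Multiset.replicate m (0 : F)).filter (· ≠ 0) = 0 :=
    Multiset.filter_eq_nil.2 fun a ha h => h (Multiset.eq_of_mem_replicate ha)
  rw [hA.roots_charpoly, Multiset.filter_add, h1, h2, add_zero]

theorem isNilpotent_mulVecLin {m : ℕ} {N : Matrix (Fin m) (Fin m) F} (hN : IsNilpotent N) :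
    IsNilpotent N.mulVecLin := by
  rw [← Matrix.toLin'_apply']
  exact hN.map (Matrix.toLinAlgEquiv' (R := F) (n := Fin m))

theorem isNilpotent_of_mulVecLin {m : ℕ} {N : Matrix (Fin m) (Fin m) F}
    (hN : IsNilpotent N.mulVecLin) : IsNilpotent N := by
  rw [← Matrix.toLin'_apply'] at hN
  have := hN.map (LinearMap.toMatrixAlgEquiv' (R := F) (n := Fin m))
  rwa [show LinearMap.toMatrixAlgEquiv' (Matrix.toLin' N) = N from
    LinearMap.toMatrixAlgEquiv'_toLinAlgEquiv' N] at this

theorem kerDim_eq_zero_of_isNilpotent {V : Type*} [AddCommGroup V] [Module F V]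
    {f : Module.End F V} (hf : IsNilpotent f) {μ : F} (hμ : μ ≠ 0) (j : ℕ) : kerDim f μ j = 0 := by
  refine kerDim_eq_zero_of_injective ?_ j
  obtain ⟨k, hk⟩ := hf
  rw [← LinearMap.ker_eq_bot, LinearMap.ker_eq_bot']
  intro x hx
  have hx' : f x = μ • x := by simpa [sub_eq_zero] using hx
  have h : ∀ k : ℕ, (f ^ k) x = μ ^ k • x := by
    intro k
    induction k with
    | zero => simp
    | succ k ih =>
      rw [pow_succ, Module.End.mul_apply, hx', map_smul, ih, smul_smul, pow_succ, mul_comm]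
  have := h k
  rw [hk, LinearMap.zero_apply, eq_comm, smul_eq_zero] at this
  exact this.resolve_left (pow_ne_zero k hμ)

theorem kerDim_zero_add_rank {n : ℕ} (A : Matrix (Fin n) (Fin n) F) (j : ℕ) :
    kerDim A.mulVecLin 0 j + (A ^ j).rank = n := by
  have h1 : A.mulVecLin ^ j = (A ^ j).mulVecLin := by
    rw [← Matrix.toLin'_apply', ← Matrix.toLin'_apply', Matrix.toLin'_pow]
  have h2 := LinearMap.finrank_range_add_finrank_ker (A ^ j).mulVecLin
  rw [Module.finrank_fin_fun] at h2
  rw [kerDim, zero_smul, sub_zero, h1, Matrix.rank, add_comm]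
  exact h2

theorem IsStarCircDecomposition.kerDim_zero {n k m : ℕ} {h : k + m = n}
    {A : Matrix (Fin n) (Fin n) F} {As : Matrix (Fin k) (Fin k) F} {Ao : Matrix (Fin m) (Fin m) F}
    (hA : IsStarCircDecomposition h A As Ao) (j : ℕ) :
    kerDim A.mulVecLin 0 j = kerDim Ao.mulVecLin 0 j := by
  rw [hA.endEquiv.kerDim_eq, kerDim_prodMap, kerDim_eq_zero_of_injective, zero_add]
  rw [zero_smul, sub_zero]
  exact Matrix.mulVec_injective_of_isUnit hA.1

/-- The nonsingular part carries exactly the nonzero roots. The nilpotent part is recovered from the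
dimensions of the kernels of powers, to which the nonsingular part contributes nothing. -/
theorem IsStarCircDecomposition.unique [IsAlgClosed F] {n k m k' m' : ℕ} {h : k + m = n}
    {A : Matrix (Fin n) (Fin n) F} {As : Matrix (Fin k) (Fin k) F} {Ao : Matrix (Fin m) (Fin m) F}
    (hA : IsStarCircDecomposition h A As Ao) {h' : k' + m' = n} {C : Matrix (Fin n) (Fin n) F}
    {Cs : Matrix (Fin k') (Fin k') F} {Co : Matrix (Fin m') (Fin m') F}
    (hC : IsStarCircDecomposition h' C Cs Co) (hroots : A.charpoly.roots = C.charpoly.roots)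
    (hrank : ∀ j, (A ^ j).rank = (C ^ j).rank) :
    As.charpoly.roots = Cs.charpoly.roots ∧ EndEquiv Ao.mulVecLin Co.mulVecLin := by
  classical
  refine ⟨by rw [← hA.filter_roots_charpoly, ← hC.filter_roots_charpoly, hroots],
    endEquiv_of_kerDim_eq fun μ j => ?_⟩
  by_cases hμ : μ = 0
  · subst hμ
    rw [← hA.kerDim_zero, ← hC.kerDim_zero]
    have h1 := kerDim_zero_add_rank A j
    have h2 := kerDim_zero_add_rank C j
    rw [hrank] at h1
    omega
  · rw [kerDim_eq_zero_of_isNilpotent (isNilpotent_mulVecLin hA.2.1) hμ,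
      kerDim_eq_zero_of_isNilpotent (isNilpotent_mulVecLin hC.2.1) hμ]

theorem isUnit_directSum {p q : ℕ} {A : Matrix (Fin p) (Fin p) F} {B : Matrix (Fin q) (Fin q) F}
    (hA : IsUnit A) (hB : IsUnit B) : IsUnit (directSum A B) := by
  rw [Matrix.isUnit_iff_isUnit_det, directSum, Matrix.det_reindex_self,
    Matrix.det_fromBlocks_zero₂₁]
  exact ((Matrix.isUnit_iff_isUnit_det _).1 hA).mul ((Matrix.isUnit_iff_isUnit_det _).1 hB)

theorem isNilpotent_directSum {p q : ℕ} {A : Matrix (Fin p) (Fin p) F}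
    {B : Matrix (Fin q) (Fin q) F} (hA : IsNilpotent A) (hB : IsNilpotent B) :
    IsNilpotent (directSum A B) := by
  obtain ⟨j, hj⟩ := hA
  obtain ⟨k, hk⟩ := hB
  refine ⟨j + k, ?_⟩
  rw [directSum, ← Matrix.coe_reindexAlgEquiv F F, ← map_pow,
    Matrix.fromBlocks_diagonal_pow, pow_add, hj, zero_mul, pow_add, hk, mul_zero,
    Matrix.fromBlocks_zero, map_zero]

theorem isUnit_jordanMatrix {L : List (ℕ × F)} (hL : ∀ b ∈ L, b.2 ≠ 0) :
    IsUnit (jordanMatrix L) := by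
  induction L with
  | nil =>
    have : jordanMatrix ([] : List (ℕ × F)) = 1 := Matrix.ext fun i => i.elim0
    rw [this]
    exact isUnit_one
  | cons b L ih =>
    refine isUnit_directSum ?_ (ih fun c hc => hL c (List.mem_cons_of_mem b hc))
    rw [Matrix.isUnit_iff_isUnit_det,
      Matrix.det_of_isUpperTriangular (isUpperTriangular_jordanBlock _ _), isUnit_iff_ne_zero,
      Finset.prod_ne_zero_iff]
    intro i _
    simpa [jordanBlock] using hL b List.mem_cons_self

theorem isNilpotent_jordanMatrix {L : List (ℕ × F)} (hL : ∀ b ∈ L, b.2 = 0) :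
    IsNilpotent (jordanMatrix L) := by
  induction L with
  | nil => exact ⟨1, Matrix.ext fun i => i.elim0⟩
  | cons b L ih =>
    refine isNilpotent_directSum ⟨b.1, ?_⟩ (ih fun c hc => hL c (List.mem_cons_of_mem b hc))
    have h := Matrix.aeval_self_charpoly (jordanBlock b.1 b.2)
    rw [Matrix.charpoly_of_isUpperTriangular _ (isUpperTriangular_jordanBlock _ _)] at h
    simpa [jordanBlock, hL b List.mem_cons_self] using h

theorem exists_isStarCircDecomposition [IsAlgClosed F] {n : ℕ} (A : Matrix (Fin n) (Fin n) F) :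
    ∃ (k m : ℕ) (h : k + m = n) (As : Matrix (Fin k) (Fin k) F) (Ao : Matrix (Fin m) (Fin m) F),
      IsStarCircDecomposition h A As Ao := by
  classical
  obtain ⟨L, -, hL⟩ := exists_endEquiv_jordanMatrix _ rfl A.mulVecLin
  -- Sort the Jordan blocks by whether their eigenvalue vanishes.
  have hp := List.filter_append_perm (fun b : ℕ × F => decide (b.2 ≠ 0)) L
  have h := (hL.trans (endEquiv_jordanMatrix_of_perm hp.symm)).trans
    (endEquiv_jordanMatrix_append _ _)
  have hn : jordanSize (L.filter fun b => decide (b.2 ≠ 0)) +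
      jordanSize (L.filter fun b => !decide (b.2 ≠ 0)) = n := by
    obtain ⟨e, -⟩ := h
    have := e.finrank_eq
    rw [Module.finrank_prod, Module.finrank_fin_fun, Module.finrank_fin_fun,
      Module.finrank_fin_fun] at this
    exact this.symm
  refine ⟨_, _, hn, _, _, isUnit_jordanMatrix (L := L.filter fun b => decide (b.2 ≠ 0)) ?_,
    isNilpotent_jordanMatrix (L := L.filter fun b => !decide (b.2 ≠ 0)) ?_, endEquiv_mulVecLin_iff.1
      (h.trans ((endEquiv_directSum _ _).symm.trans (endEquiv_castMatrix hn _).symm))⟩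
  · intro b hb
    simpa using (List.mem_filter.1 hb).2
  · intro b hb
    simpa using (List.mem_filter.1 hb).2

theorem endEquiv_iff_exists_similarMatrix {m m' : ℕ} {A : Matrix (Fin m) (Fin m) F}
    {C : Matrix (Fin m') (Fin m') F} :
    EndEquiv A.mulVecLin C.mulVecLin ↔ ∃ e : m' = m, SimilarMatrix A (castMatrix e C) := by
  constructor
  · intro h
    have e : m' = m := by
      obtain ⟨e, -⟩ := h
      simpa using e.finrank_eq.symm
    subst e
    exact ⟨rfl, endEquiv_mulVecLin_iff.1 h⟩
  · rintro ⟨rfl, h⟩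
    exact endEquiv_mulVecLin_iff.2 h

end Decompositions

/-! ### Classification of affine operators -/

section Classification

variable {F : Type*} [Field F]

/-- The linear part of an almost diagonal operator. -/
def almostDiagonalMatrix {n p m : ℕ} (h : (p + 1) + m = n) (α : Fin p → F)
    (J : Matrix (Fin m) (Fin m) F) : Matrix (Fin n) (Fin n) F :=
  castMatrix h (directSum (Matrix.diagonal (Fin.cons 1 α : Fin (p + 1) → F)) J)

/-- The first vector of the standard basis. -/
def firstBasisVector (F : Type*) [Field F] {n p m : ℕ} (h : (p + 1) + m = n) : Fin n → F :=
  fun i => Fin.append (Fin.cons 1 0 : Fin (p + 1) → F) (0 : Fin m → F) (Fin.cast h.symm i)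

theorem directSum_mulVec_castAdd {p q : ℕ} (A : Matrix (Fin p) (Fin p) F)
    (B : Matrix (Fin q) (Fin q) F) (x : Fin (p + q) → F) (i : Fin p) :
    (directSum A B *ᵥ x) (Fin.castAdd q i) = (A *ᵥ fun j => x (Fin.castAdd q j)) i := by
  rw [directSum, Matrix.reindex_apply, Matrix.submatrix_mulVec_equiv, Equiv.symm_symm]
  simp [Matrix.fromBlocks_mulVec]
  rfl

theorem directSum_mulVec_natAdd {p q : ℕ} (A : Matrix (Fin p) (Fin p) F)
    (B : Matrix (Fin q) (Fin q) F) (x : Fin (p + q) → F) (i : Fin q) :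
    (directSum A B *ᵥ x) (Fin.natAdd p i) = (B *ᵥ fun j => x (Fin.natAdd p j)) i := by
  rw [directSum, Matrix.reindex_apply, Matrix.submatrix_mulVec_equiv, Equiv.symm_symm]
  simp [Matrix.fromBlocks_mulVec]
  rfl

theorem almostDiagonalOperator_eq {n p m : ℕ} (h : (p + 1) + m = n) (α : Fin p → F)
    (J : Matrix (Fin m) (Fin m) F) : almostDiagonalOperator h α J =
      affineOperator (almostDiagonalMatrix h α J) (firstBasisVector F h) := by
  subst h
  funext x i
  rw [almostDiagonalMatrix, castMatrix_rfl, affineOperator, Pi.add_apply]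
  refine Fin.addCases (fun i => ?_) (fun i => ?_) i
  · rw [directSum_mulVec_castAdd, Matrix.mulVec_diagonal]
    refine Fin.cases ?_ (fun i => ?_) i <;> simp [almostDiagonalOperator, firstBasisVector]
  · rw [directSum_mulVec_natAdd]
    simp [almostDiagonalOperator, firstBasisVector]

theorem almostDiagonalOperator_smul {n p m : ℕ} (h : (p + 1) + m = n) (α : Fin p → F)
    (J : Matrix (Fin m) (Fin m) F) (t : F) :
    almostDiagonalOperator h α J (t • firstBasisVector F h) = (t + 1) • firstBasisVector F h := by
  subst h
  funext i
  refine Fin.addCases (fun i => ?_) (fun i => ?_) i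
  · refine Fin.cases ?_ (fun i => ?_) i <;> simp [almostDiagonalOperator, firstBasisVector]
  · have : (fun _ : Fin m => (0 : F)) = 0 := rfl
    simp [almostDiagonalOperator, firstBasisVector, this]

theorem not_hasFixedPoint_almostDiagonalOperator {n p m : ℕ} (h : (p + 1) + m = n) (α : Fin p → F)
    (J : Matrix (Fin m) (Fin m) F) : ¬ HasFixedPoint (almostDiagonalOperator h α J) := by
  subst h
  rintro ⟨x, hx⟩
  have := congrFun hx (Fin.castAdd m 0)
  simp [almostDiagonalOperator] at this

theorem isStarCircDecomposition_almostDiagonalMatrix {n p m : ℕ} (h : (p + 1) + m = n)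
    {α : Fin p → F} (hα : ∀ i, α i ≠ 0) {J : Matrix (Fin m) (Fin m) F} (hJ : IsNilpotent J) :
    IsStarCircDecomposition h (almostDiagonalMatrix h α J)
      (Matrix.diagonal (Fin.cons 1 α : Fin (p + 1) → F)) J := by
  refine ⟨?_, hJ, endEquiv_mulVecLin_iff.1 (EndEquiv.refl _)⟩
  rw [Matrix.isUnit_iff_isUnit_det, Matrix.det_diagonal, isUnit_iff_ne_zero,
    Finset.prod_ne_zero_iff]
  intro i _
  exact Fin.cases one_ne_zero hα i

theorem roots_charpoly_diagonal_cons {p : ℕ} (α : Fin p → F) :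
    (Matrix.diagonal (Fin.cons 1 α : Fin (p + 1) → F)).charpoly.roots =
      ((1 :: List.ofFn α : List F) : Multiset F) := by
  have h := Polynomial.roots_multiset_prod_X_sub_C
    (Finset.univ.val.map (Fin.cons 1 α : Fin (p + 1) → F))
  rw [Multiset.map_map, Fin.univ_val_map (Fin.cons 1 α : Fin (p + 1) → F), List.ofFn_cons] at h
  rw [Matrix.charpoly_diagonal]
  exact h

/-- Corresponding fibres have equal size; bijections between them glue. -/
theorem exists_perm_of_perm_ofFn {X : Type*} {p : ℕ} {f g : Fin p → X}
    (h : (List.ofFn f).Perm (List.ofFn g)) : ∃ σ : Equiv.Perm (Fin p), ∀ i, f i = g (σ i) := by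
  classical
  have hcard : ∀ a, Fintype.card {i // f i = a} = Fintype.card {i // g i = a} := by
    intro a
    have h1 := congrArg (Multiset.count a) (Multiset.coe_eq_coe.2 h)
    rw [← Fin.univ_val_map, ← Fin.univ_val_map, Multiset.count_map, Multiset.count_map] at h1
    simp only [eq_comm (a := a)] at h1
    rw [Fintype.card_subtype, Fintype.card_subtype]
    exact h1
  exact ⟨(Equiv.sigmaFiberEquiv f).symm.trans ((Equiv.sigmaCongrRight fun a =>
    Fintype.equivOfCardEq (hcard a)).trans (Equiv.sigmaFiberEquiv g)), fun i =>
      (Fintype.equivOfCardEq (hcard (f i)) ⟨i, rfl⟩).2.symm⟩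

theorem biregularlyConjugate_almostDiagonalOperator_of_perm {p m p' m' n : ℕ} (h : (p + 1) + m = n) (h' : (p' + 1) + m' = n)
    {α : Fin p → F} {α' : Fin p' → F} (hα : (List.ofFn α).Perm (List.ofFn α'))
    {J : Matrix (Fin m) (Fin m) F} {J' : Matrix (Fin m') (Fin m') F}
    (hJ : EndEquiv J.mulVecLin J'.mulVecLin) :
    BiregularlyConjugate (almostDiagonalOperator h α J) (almostDiagonalOperator h' α' J') := by
  obtain rfl : p = p' := by simpa using hα.length_eq
  obtain ⟨σ, rfl⟩ : ∃ σ : Equiv.Perm (Fin p), α' = α ∘ σ := by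
    obtain ⟨σ, hσ⟩ := exists_perm_of_perm_ofFn hα.symm
    exact ⟨σ, funext hσ⟩
  obtain ⟨e, he⟩ := hJ
  rw [biregularlyConjugate_iff]
  refine (polyConj_almostDiagonalOperator h α J).symm.trans (PolyConj.trans ?_
    (polyConj_almostDiagonalOperator h' (α ∘ σ) J'))
  exact PolyConj.of_linearEquiv ((LinearEquiv.refl F F).prodCongr
    ((LinearEquiv.funCongrLeft F F σ).prodCongr e)) fun x =>
      Prod.ext rfl (Prod.ext rfl (he x.2.2))

theorem BiregularlyConjugate.symm {n : ℕ} {f g : (Fin n → F) → (Fin n → F)}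
    (h : BiregularlyConjugate f g) : BiregularlyConjugate g f :=
  biregularlyConjugate_iff.2 (biregularlyConjugate_iff.1 h).symm

theorem BiregularlyConjugate.trans {n : ℕ} {f g k : (Fin n → F) → (Fin n → F)}
    (h : BiregularlyConjugate f g) (h' : BiregularlyConjugate g k) : BiregularlyConjugate f k :=
  biregularlyConjugate_iff.2 ((biregularlyConjugate_iff.1 h).trans (biregularlyConjugate_iff.1 h'))

theorem biregularlyConjugate_linear {n : ℕ} {A : Matrix (Fin n) (Fin n) F} {b : Fin n → F}
    (h : HasFixedPoint (affineOperator A b)) :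
    BiregularlyConjugate (affineOperator A b) (affineOperator A 0) := by
  obtain ⟨v, hv⟩ := h
  refine biregularlyConjugate_iff.2 (PolyConj.of_translation v fun x => ?_)
  conv_lhs => rw [← hv]
  simp only [affineOperator, Matrix.mulVec_add]
  abel

theorem hasFixedPoint_linear {n : ℕ} (A : Matrix (Fin n) (Fin n) F) :
    HasFixedPoint (affineOperator A 0) := ⟨0, by simp [affineOperator]⟩

theorem biregularlyConjugate_iff_of_hasFixedPoint [Infinite F] {n : ℕ}
    {A C : Matrix (Fin n) (Fin n) F} {b d : Fin n → F} (hA : HasFixedPoint (affineOperator A b))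
    (hC : HasFixedPoint (affineOperator C d)) :
    BiregularlyConjugate (affineOperator A b) (affineOperator C d) ↔ SimilarMatrix A C := by
  refine ⟨similarMatrix_of_fixedPoint hC, fun h => ?_⟩
  obtain ⟨e, he⟩ := endEquiv_mulVecLin_iff.2 h
  refine ((biregularlyConjugate_linear hA).trans ?_).trans (biregularlyConjugate_linear hC).symm
  refine biregularlyConjugate_iff.2 (PolyConj.of_linearEquiv e fun x => ?_)
  simpa [affineOperator] using he x

theorem endEquiv_iff_perm {n n' : ℕ} {J : Matrix (Fin n) (Fin n) F}
    {J' : Matrix (Fin n') (Fin n') F} {L L' : List (ℕ × F)} (hJ : IsJordanMatrix J L)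
    (hJ' : IsJordanMatrix J' L') : EndEquiv J.mulVecLin J'.mulVecLin ↔ L.Perm L' := by
  rw [← endEquiv_jordanMatrix_iff hJ.1 hJ'.1]
  exact ⟨fun h => hJ.endEquiv.symm.trans (h.trans hJ'.endEquiv),
    fun h => hJ.endEquiv.trans (h.trans hJ'.endEquiv.symm)⟩

variable [IsAlgClosed F] [CharZero F]

/-- The second operator itself need not translate any line, but its almost diagonal form does; both
spectra are compared with that form. -/
theorem roots_charpoly_eq_of_not_hasFixedPoint {n : ℕ} {A C : Matrix (Fin n) (Fin n) F}
    {b d : Fin n → F} (hC : ¬ HasFixedPoint (affineOperator C d))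
    (h : BiregularlyConjugate (affineOperator A b) (affineOperator C d)) :
    A.charpoly.roots = C.charpoly.roots := by
  obtain ⟨p, m, hn, α, N, -, -, hc⟩ := exists_conj_almostDiagonalOperator C d hC
  have hline : ∀ t : F, affineOperator (almostDiagonalMatrix hn α N) (firstBasisVector F hn)
      (0 + t • firstBasisVector F hn) = 0 + (t + 1) • firstBasisVector F hn := fun t => by
    rw [zero_add, zero_add, ← almostDiagonalOperator_eq, almostDiagonalOperator_smul]
  have hc' := h.trans hc
  rw [almostDiagonalOperator_eq] at hc hc'
  rw [charpoly_roots_eq_of_biregularlyConjugate hc' _ _ hline,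
    charpoly_roots_eq_of_biregularlyConjugate hc _ _ hline]

theorem star_circ_eq_of_biregularlyConjugate {n k m k' m' : ℕ} {A C : Matrix (Fin n) (Fin n) F}
    {b d : Fin n → F} (hC : ¬ HasFixedPoint (affineOperator C d))
    {h : k + m = n} {As : Matrix (Fin k) (Fin k) F} {Ao : Matrix (Fin m) (Fin m) F}
    {h' : k' + m' = n} {Cs : Matrix (Fin k') (Fin k') F} {Co : Matrix (Fin m') (Fin m') F}
    (dA : IsStarCircDecomposition h A As Ao) (dC : IsStarCircDecomposition h' C Cs Co)
    (hc : BiregularlyConjugate (affineOperator A b) (affineOperator C d)) :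
    As.charpoly.roots = Cs.charpoly.roots ∧ EndEquiv Ao.mulVecLin Co.mulVecLin :=
  have : Infinite F := IsAlgClosed.instInfinite
  dA.unique dC (roots_charpoly_eq_of_not_hasFixedPoint hC hc)
    (rank_pow_eq_of_biregularlyConjugate hc)

/-- The reduction yields a normal form with unspecified data; the invariants identify them with
those of `A`. In particular `1` is an eigenvalue of `As`. -/
theorem exists_canonical_form {n k m : ℕ} {A : Matrix (Fin n) (Fin n) F} {b : Fin n → F}
    (hA : ¬ HasFixedPoint (affineOperator A b)) {h : k + m = n} {As : Matrix (Fin k) (Fin k) F}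
    {Ao : Matrix (Fin m) (Fin m) F} (dA : IsStarCircDecomposition h A As Ao) :
    ∃ (p m' : ℕ) (h' : (p + 1) + m' = n) (α : Fin p → F) (N : Matrix (Fin m') (Fin m') F),
      (∀ i, α i ≠ 0) ∧ IsNilpotent N ∧
      BiregularlyConjugate (affineOperator A b) (almostDiagonalOperator h' α N) ∧
      As.charpoly.roots = ((1 :: List.ofFn α : List F) : Multiset F) ∧
      EndEquiv Ao.mulVecLin N.mulVecLin := by
  obtain ⟨p, m', h', α, N, hα, hN, hc⟩ := exists_conj_almostDiagonalOperator A b hA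
  refine ⟨p, m', h', α, N, hα, hN, hc, ?_⟩
  rw [almostDiagonalOperator_eq] at hc
  rw [← roots_charpoly_diagonal_cons]
  refine star_circ_eq_of_biregularlyConjugate ?_ dA
    (isStarCircDecomposition_almostDiagonalMatrix h' hα hN) hc
  rw [← almostDiagonalOperator_eq]
  exact not_hasFixedPoint_almostDiagonalOperator h' α N

/-- Sufficiency holds because equal invariants give normal forms that differ by a permutation of
coordinates and a linear isomorphism of the nilpotent parts. -/
theorem biregularlyConjugate_iff_of_not_hasFixedPoint {n k m k' m' : ℕ}
    {A C : Matrix (Fin n) (Fin n) F} {b d : Fin n → F} (hA : ¬ HasFixedPoint (affineOperator A b))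
    (hC : ¬ HasFixedPoint (affineOperator C d))
    {h : k + m = n} {As : Matrix (Fin k) (Fin k) F} {Ao : Matrix (Fin m) (Fin m) F}
    {h' : k' + m' = n} {Cs : Matrix (Fin k') (Fin k') F} {Co : Matrix (Fin m') (Fin m') F}
    (dA : IsStarCircDecomposition h A As Ao) (dC : IsStarCircDecomposition h' C Cs Co) :
    BiregularlyConjugate (affineOperator A b) (affineOperator C d) ↔
      As.charpoly.roots = Cs.charpoly.roots ∧ EndEquiv Ao.mulVecLin Co.mulVecLin := by
  refine ⟨star_circ_eq_of_biregularlyConjugate hC dA dC, fun ⟨hs, ho⟩ => ?_⟩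
  obtain ⟨p, q, e, α, N, -, -, hc, hr, hN⟩ := exists_canonical_form hA dA
  obtain ⟨p', q', e', α', N', -, -, hc', hr', hN'⟩ := exists_canonical_form hC dC
  refine hc.trans ((biregularlyConjugate_almostDiagonalOperator_of_perm e e' ?_ (hN.symm.trans (ho.trans hN'))).trans hc'.symm)
  rw [hr, hr', Multiset.coe_eq_coe, List.perm_cons] at hs
  exact hs

theorem biregularlyConjugate_almostDiagonalOperator_iff {n p m k m' : ℕ} (h : (p + 1) + m = n)
    {α : Fin p → F} (hα : ∀ i, α i ≠ 0) {J : Matrix (Fin m) (Fin m) F} (hJ : IsNilpotent J)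
    {A : Matrix (Fin n) (Fin n) F} {b : Fin n → F} (hA : ¬ HasFixedPoint (affineOperator A b))
    {h' : k + m' = n} {As : Matrix (Fin k) (Fin k) F} {Ao : Matrix (Fin m') (Fin m') F}
    (dA : IsStarCircDecomposition h' A As Ao) :
    BiregularlyConjugate (affineOperator A b) (almostDiagonalOperator h α J) ↔
      As.charpoly.roots = ((1 :: List.ofFn α : List F) : Multiset F) ∧
        EndEquiv Ao.mulVecLin J.mulVecLin := by
  have hC := not_hasFixedPoint_almostDiagonalOperator h α J
  rw [almostDiagonalOperator_eq] at hC ⊢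
  rw [← roots_charpoly_diagonal_cons]
  exact biregularlyConjugate_iff_of_not_hasFixedPoint hA hC dA
    (isStarCircDecomposition_almostDiagonalMatrix h hα hJ)

end Classification

end AffineBiregular

theorem theorem2 {F : Type*} [Field F] [IsAlgClosed F] [CharZero F] (n : ℕ) :
    -- every matrix is similar to (nonsingular) ⊕ (nilpotent)
    (∀ A : Matrix (Fin n) (Fin n) F,
      ∃ (k m : ℕ) (h : k + m = n) (As : Matrix (Fin k) (Fin k) F) (Ao : Matrix (Fin m) (Fin m) F),
        IsStarCircDecomposition h A As Ao) ∧
    -- (a)(i)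
    (∀ (A C : Matrix (Fin n) (Fin n) F) (b d : Fin n → F),
      HasFixedPoint (affineOperator A b) → HasFixedPoint (affineOperator C d) →
      (BiregularlyConjugate (affineOperator A b) (affineOperator C d) ↔ SimilarMatrix A C)) ∧
    -- (a)(ii)
    (∀ (A C : Matrix (Fin n) (Fin n) F) (b d : Fin n → F),
      ¬ HasFixedPoint (affineOperator A b) → ¬ HasFixedPoint (affineOperator C d) →
      ∀ (k m : ℕ) (h : k + m = n) (As : Matrix (Fin k) (Fin k) F) (Ao : Matrix (Fin m) (Fin m) F)
        (k' m' : ℕ) (h' : k' + m' = n) (Cs : Matrix (Fin k') (Fin k') F)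
        (Co : Matrix (Fin m') (Fin m') F),
      IsStarCircDecomposition h A As Ao → IsStarCircDecomposition h' C Cs Co →
      (BiregularlyConjugate (affineOperator A b) (affineOperator C d) ↔
        As.charpoly.roots = Cs.charpoly.roots ∧
          ∃ e : m' = m, SimilarMatrix Ao (castMatrix e Co))) ∧
    -- (b)(i)
    (∀ (A : Matrix (Fin n) (Fin n) F) (b : Fin n → F), HasFixedPoint (affineOperator A b) →
      -- a Jordan canonical form of `A` exists
      (∃ (J : Matrix (Fin n) (Fin n) F) (L : List (ℕ × F)), IsJordanForm A J L) ∧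
      -- the operator is conjugate to `x ↦ J x` for each Jordan canonical form `J` of `A`
      (∀ (J : Matrix (Fin n) (Fin n) F) (L : List (ℕ × F)), IsJordanForm A J L →
        BiregularlyConjugate (affineOperator A b) (fun x => J *ᵥ x)) ∧
      -- uniqueness up to permutation of blocks
      (∀ (J J' : Matrix (Fin n) (Fin n) F) (L L' : List (ℕ × F)),
        IsJordanMatrix J L → IsJordanMatrix J' L' →
        BiregularlyConjugate (affineOperator A b) (fun x => J *ᵥ x) →
        (BiregularlyConjugate (affineOperator A b) (fun x => J' *ᵥ x) ↔ L.Perm L'))) ∧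
    -- (b)(ii)
    (∀ (A : Matrix (Fin n) (Fin n) F) (b : Fin n → F), ¬ HasFixedPoint (affineOperator A b) →
      (∀ (k m : ℕ) (h : k + m = n) (As : Matrix (Fin k) (Fin k) F) (Ao : Matrix (Fin m) (Fin m) F),
        IsStarCircDecomposition h A As Ao →
        -- the data of the canonical form exist
        (∃ (p : ℕ) (α : Fin p → F) (J : Matrix (Fin m) (Fin m) F) (L : List (ℕ × F)),
          p + 1 = k ∧ (∀ i, α i ≠ 0) ∧
          As.charpoly.roots = ((1 :: List.ofFn α : List F) : Multiset F) ∧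
          IsJordanForm Ao J L) ∧
        -- and the operator is conjugate to each canonical form so obtained
        (∀ (p : ℕ) (hp : p + 1 = k) (α : Fin p → F) (J : Matrix (Fin m) (Fin m) F)
          (L : List (ℕ × F)),
          As.charpoly.roots = ((1 :: List.ofFn α : List F) : Multiset F) →
          IsJordanForm Ao J L →
          BiregularlyConjugate (affineOperator A b)
            (almostDiagonalOperator (show (p + 1) + m = n by rw [hp, h]) α J))) ∧
      -- uniqueness up to permutation of the `α i` and of the blocks
      (∀ (p m : ℕ) (h : (p + 1) + m = n) (α : Fin p → F) (J : Matrix (Fin m) (Fin m) F)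
        (L : List (ℕ × F)) (p' m' : ℕ) (h' : (p' + 1) + m' = n) (α' : Fin p' → F)
        (J' : Matrix (Fin m') (Fin m') F) (L' : List (ℕ × F)),
        (∀ i, α i ≠ 0) → (∀ i, α' i ≠ 0) → IsNilpotent J → IsNilpotent J' →
        IsJordanMatrix J L → IsJordanMatrix J' L' →
        BiregularlyConjugate (affineOperator A b) (almostDiagonalOperator h α J) →
        (BiregularlyConjugate (affineOperator A b) (almostDiagonalOperator h' α' J') ↔
          (List.ofFn α).Perm (List.ofFn α') ∧ L.Perm L'))) := by
  have : Infinite F := IsAlgClosed.instInfinite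
  refine ⟨exists_isStarCircDecomposition, fun A C b d => biregularlyConjugate_iff_of_hasFixedPoint,
    ?_, ?_, ?_⟩
  · intro A C b d hA hC k m h As Ao k' m' h' Cs Co dA dC
    rw [biregularlyConjugate_iff_of_not_hasFixedPoint hA hC dA dC,
      endEquiv_iff_exists_similarMatrix]
  · intro A b hA
    have key : ∀ J : Matrix (Fin n) (Fin n) F,
        BiregularlyConjugate (affineOperator A b) (fun x => J *ᵥ x) ↔ SimilarMatrix A J := by
      intro J
      have hJ : affineOperator J 0 = fun x => J *ᵥ x := funext fun x => add_zero _
      rw [← biregularlyConjugate_iff_of_hasFixedPoint hA (hasFixedPoint_linear J), hJ]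
    refine ⟨exists_isJordanForm A, fun J L hJ => (key J).2 hJ.2, fun J J' L L' hJ hJ' hc => ?_⟩
    rw [key] at hc ⊢
    rw [← endEquiv_iff_perm hJ hJ', ← endEquiv_mulVecLin_iff]
    rw [← endEquiv_mulVecLin_iff] at hc
    exact ⟨hc.symm.trans, hc.trans⟩
  · intro A b hA
    refine ⟨fun k m h As Ao dA => ⟨?_, fun p hp α J L hr hJ => ?_⟩, ?_⟩
    · obtain ⟨p, m', h', α, N, hα, -, -, hr, hN⟩ := exists_canonical_form hA dA
      obtain ⟨J, L, hJ⟩ := exists_isJordanForm Ao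
      obtain rfl : m' = m := (endEquiv_iff_exists_similarMatrix.1 hN).1
      exact ⟨p, α, J, L, by omega, hα, hr, hJ⟩
    -- Not assumed: the `α i` are roots of the characteristic polynomial of a nonsingular matrix.
    · have hα : ∀ i, α i ≠ 0 := by
        intro i h0
        refine zero_notMem_roots_charpoly dA.1 ?_
        rw [hr, Multiset.mem_coe, ← h0]
        exact List.mem_cons_of_mem _ ((List.mem_ofFn' α _).2 ⟨i, rfl⟩)
      have hAJ := endEquiv_mulVecLin_iff.2 hJ.2
      have hJn := isNilpotent_of_mulVecLin (hAJ.isNilpotent (isNilpotent_mulVecLin dA.2.1))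
      exact (biregularlyConjugate_almostDiagonalOperator_iff _ hα hJn hA dA).2 ⟨hr, hAJ⟩
    · intro p m h α J L p' m' h' α' J' L' hα hα' hJ hJ' hL hL' hc
      -- Any decomposition of `A` serves: both normal forms are compared with its data, and the
      -- common root `1` cancels.
      obtain ⟨k, q, e, As, Ao, dA⟩ := exists_isStarCircDecomposition A
      rw [biregularlyConjugate_almostDiagonalOperator_iff h hα hJ hA dA] at hc
      rw [biregularlyConjugate_almostDiagonalOperator_iff h' hα' hJ' hA dA, hc.1,
        Multiset.coe_eq_coe, List.perm_cons, ← endEquiv_iff_perm hL hL']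
      exact and_congr_right fun _ => ⟨hc.2.symm.trans, hc.2.trans⟩
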